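/- Let $K$ be a field of characteristic $0$, let $m\ge 2$, let $L_m$ be the free Lie algebra over $K$ on $m$ generators, and let $F_m=L_m/L_m''$ be the free metabelian Lie algebra of rank $m$, with free generators $y_1,\dots,y_m$. Let $\widehat{F_m}=\varprojlim_k F_m/F_m^{k}$ be the completion of $F_m$ in the formal power series topology. All operators are written on the right of their arguments: for $v\in\widehat{F_m}$ the operator $\mathrm{ad}\,v$ is given by $x(\mathrm{ad}\,v)=[x,v]$, one sets $\exp(\mathrm{ad}\,v)=\sum_{n\ge 0}(\mathrm{ad}\,v)^n/n!$, and in a product of operators the left factor is applied first. For $f(t_1,t_2)=\sum_{a,b}f_{ab}t_1^at_2^b\in K[[t_1,t_2]]$ and $p,q,x\in\widehat{F_m}$ put $x\,f(\mathrm{ad}\,p,\mathrm{ad}\,q)=\sum_{a,b}f_{ab}\,x(\mathrm{ad}\,p)^a(\mathrm{ad}\,q)^b$. For $u\in\widehat{F_m}$ write $u=\overline{u}+u_0$, where $\overline{u}\in Ky_1+\dots+Ky_m$ is the linear component of $u$ and $u_0$ lies in the completed commutator ideal (the kernel of $\widehat{F_m}\to F_m/F_m^2$). Put $$h(t)=\frac{e^t-1}{t}\in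 K[[t]],\qquad c(t_1,t_2)=\frac{e^{t_2}h(t_1)-h(t_2)}{e^{t_1+t_2}-1}\in K[[t_1,t_2]],$$ where $c$ denotes the unique formal power series whose product with $e^{t_1+t_2}-1$ is $e^{t_2}h(t_1)-h(t_2)$, and $$H(\overline{u},\overline{v})=\overline{u}+\overline{v}+[\overline{u},\overline{v}]\,c(\mathrm{ad}\,\overline{u},\mathrm{ad}\,\overline{v}).$$ **Theorem.** Let $u,v\in\widehat{F_m}$. Then the equation $\exp(\mathrm{ad}\,u)\cdot\exp(\mathrm{ad}\,v)=\exp(\mathrm{ad}\,w)$ has exactly one solution $w\in\widehat{F_m}$, namely $$w=H(\overline{u},\overline{v})+u_0\bigl(1+(\mathrm{ad}\,\overline{v})\,c(\mathrm{ad}\,\overline{u},\mathrm{ad}\,\overline{v})\bigr)+v_0\bigl(1-(\mathrm{ad}\,\overline{u})\,c(\mathrm{ad}\,\overline{u},\mathrm{ad}\,\overline{v})\bigr).$$ -/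

import Mathlib

noncomputable section

/-! ### Completion of a Lie algebra in the formal power series topology -/

/-- The compatible sequences `(x_k)`, `x_k ∈ L / L^{k+1}`.  Here `L^{k+1}` is
`LieModule.lowerCentralSeries R L L k` (Mathlib starts counting at `0`).  Compatibility: every
representative of `x_{k+1}` is also a representative of `x_k`. -/
def lieCompletionSubmodule (R L : Type*) [CommRing R] [LieRing L] [LieAlgebra R L] :
    Submodule R (∀ k : ℕ, L ⧸ LieModule.lowerCentralSeries R L L k) where
  carrier := {x | ∀ (k : ℕ) (a : L),
    (LieSubmodule.Quotient.mk a : L ⧸ LieModule.lowerCentralSeries R L L (k + 1)) = x (k + 1) →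
    (LieSubmodule.Quotient.mk a : L ⧸ LieModule.lowerCentralSeries R L L k) = x k}
  add_mem' := by
    intro x y hx hy k a ha
    obtain ⟨b, hb⟩ := LieSubmodule.Quotient.surjective_mk' _ (x (k + 1))
    have h1 := hx k b hb
    have h2 : (LieSubmodule.Quotient.mk (a - b) :
        L ⧸ LieModule.lowerCentralSeries R L L (k + 1)) = y (k + 1) := by
      have hb' : (LieSubmodule.Quotient.mk b :
        L ⧸ LieModule.lowerCentralSeries R L L (k + 1)) = x (k + 1) := hb
      have : (LieSubmodule.Quotient.mk (a - b) :
        L ⧸ LieModule.lowerCentralSeries R L L (k + 1)) =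
          LieSubmodule.Quotient.mk a - LieSubmodule.Quotient.mk b := rfl
      rw [this, ha, hb']
      simp
    have h3 := hy k (a - b) h2
    have : (LieSubmodule.Quotient.mk (a - b) :
        L ⧸ LieModule.lowerCentralSeries R L L k) =
          LieSubmodule.Quotient.mk a - LieSubmodule.Quotient.mk b := rfl
    rw [this, h1, sub_eq_iff_eq_add, add_comm] at h3
    exact h3
  zero_mem' := by
    intro k a ha
    have h : a ∈ LieModule.lowerCentralSeries R L L (k + 1) :=
      LieSubmodule.Quotient.mk_eq_zero'.1 ha
    exact LieSubmodule.Quotient.mk_eq_zero'.2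
      (LieModule.antitone_lowerCentralSeries R L L (Nat.le_succ k) h)
  smul_mem' := by
    intro c x hx k a ha
    obtain ⟨b, hb⟩ := LieSubmodule.Quotient.surjective_mk' _ (x (k + 1))
    have h1 := hx k b hb
    have hb' : (LieSubmodule.Quotient.mk b :
        L ⧸ LieModule.lowerCentralSeries R L L (k + 1)) = x (k + 1) := hb
    have h2 : (LieSubmodule.Quotient.mk (a - c • b) :
        L ⧸ LieModule.lowerCentralSeries R L L (k + 1)) = 0 := by
      have : (LieSubmodule.Quotient.mk (a - c • b) :
        L ⧸ LieModule.lowerCentralSeries R L L (k + 1)) =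
          LieSubmodule.Quotient.mk a - c • LieSubmodule.Quotient.mk b := rfl
      rw [this, ha, hb']
      simp
    have h3 := LieModule.antitone_lowerCentralSeries R L L (Nat.le_succ k)
      (LieSubmodule.Quotient.mk_eq_zero'.1 h2)
    have h4 : (LieSubmodule.Quotient.mk (a - c • b) :
        L ⧸ LieModule.lowerCentralSeries R L L k) = 0 := LieSubmodule.Quotient.mk_eq_zero'.2 h3
    have : (LieSubmodule.Quotient.mk (a - c • b) :
        L ⧸ LieModule.lowerCentralSeries R L L k) =
          LieSubmodule.Quotient.mk a - c • LieSubmodule.Quotient.mk b := rfl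
    rw [this, h1, sub_eq_zero] at h4
    exact h4

/-- The completion `lim L / L^k` of the Lie algebra `L` in the formal power series topology. -/
abbrev LieCompletion (R L : Type*) [CommRing R] [LieRing L] [LieAlgebra R L] : Type _ :=
  lieCompletionSubmodule R L

namespace LieCompletion

section General

variable {R L : Type*} [CommRing R] [LieRing L] [LieAlgebra R L]

/-- The projection of the completion onto `L / L^{k+1}`. -/
def proj (k : ℕ) (x : LieCompletion R L) : L ⧸ LieModule.lowerCentralSeries R L L k := x.1 k

@[ext]
theorem ext {x y : LieCompletion R L} (h : ∀ k, proj k x = proj k y) : x = y :=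
  Subtype.ext (funext h)

@[simp] theorem proj_add (k : ℕ) (x y : LieCompletion R L) :
    proj k (x + y) = proj k x + proj k y := rfl

@[simp] theorem proj_zero (k : ℕ) : proj k (0 : LieCompletion R L) = 0 := rfl

@[simp] theorem proj_smul (k : ℕ) (c : R) (x : LieCompletion R L) :
    proj k (c • x) = c • proj k x := rfl

/-- The bracket is computed in every quotient `L / L^{k+1}`. -/
instance : Bracket (LieCompletion R L) (LieCompletion R L) where
  bracket x y := ⟨fun k => ⁅proj k x, proj k y⁆, by
    intro k a ha
    obtain ⟨b, hb⟩ := LieSubmodule.Quotient.surjective_mk' _ (x.1 (k + 1))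
    obtain ⟨d, hd⟩ := LieSubmodule.Quotient.surjective_mk' _ (y.1 (k + 1))
    have h1 := x.2 k b hb
    have h2 := y.2 k d hd
    have h3 : (LieSubmodule.Quotient.mk (a - ⁅b, d⁆) :
        L ⧸ LieModule.lowerCentralSeries R L L (k + 1)) = 0 := by
      have : (LieSubmodule.Quotient.mk (a - ⁅b, d⁆) :
        L ⧸ LieModule.lowerCentralSeries R L L (k + 1)) =
          LieSubmodule.Quotient.mk a -
            ⁅(LieSubmodule.Quotient.mk b : L ⧸ LieModule.lowerCentralSeries R L L (k + 1)),
              LieSubmodule.Quotient.mk d⁆ := rfl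
      rw [this, ha, sub_eq_zero]
      exact congrArg₂ (fun p q => ⁅p, q⁆) hb.symm hd.symm
    have h4 := LieModule.antitone_lowerCentralSeries R L L (Nat.le_succ k)
      (LieSubmodule.Quotient.mk_eq_zero'.1 h3)
    have h5 : (LieSubmodule.Quotient.mk (a - ⁅b, d⁆) :
        L ⧸ LieModule.lowerCentralSeries R L L k) = 0 := LieSubmodule.Quotient.mk_eq_zero'.2 h4
    have : (LieSubmodule.Quotient.mk (a - ⁅b, d⁆) :
        L ⧸ LieModule.lowerCentralSeries R L L k) =
          LieSubmodule.Quotient.mk a -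
            ⁅(LieSubmodule.Quotient.mk b : L ⧸ LieModule.lowerCentralSeries R L L k),
              LieSubmodule.Quotient.mk d⁆ := rfl
    rw [this, h1, h2, sub_eq_zero] at h5
    exact h5⟩

@[simp] theorem proj_lie (k : ℕ) (x y : LieCompletion R L) :
    proj k ⁅x, y⁆ = ⁅proj k x, proj k y⁆ := rfl

instance : LieRing (LieCompletion R L) where
  add_lie x y z := by ext k; simp
  lie_add x y z := by ext k; simp
  lie_self x := by ext k; simp
  leibniz_lie x y z := by ext k; simp

instance : LieAlgebra R (LieCompletion R L) where
  lie_smul c x y := by ext k; simp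

/-- The canonical map of `L` into its completion. -/
def ofLie (a : L) : LieCompletion R L :=
  ⟨fun _ => LieSubmodule.Quotient.mk a, by
    intro k b hb
    have h : (LieSubmodule.Quotient.mk (b - a) :
        L ⧸ LieModule.lowerCentralSeries R L L (k + 1)) = 0 := sub_eq_zero.2 hb
    have h' : (LieSubmodule.Quotient.mk (b - a) :
        L ⧸ LieModule.lowerCentralSeries R L L k) = 0 :=
      LieSubmodule.Quotient.mk_eq_zero'.2
        (LieModule.antitone_lowerCentralSeries R L L (Nat.le_succ k)
          (LieSubmodule.Quotient.mk_eq_zero'.1 h))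
    exact sub_eq_zero.1 h'⟩

/-- The formal power series topology on the completion: the projective limit of the discrete
topologies on the quotients `L / L^{k+1}`. -/
instance : TopologicalSpace (LieCompletion R L) :=
  ⨅ k : ℕ, TopologicalSpace.induced (proj k) ⊥

/-- The operator `ad v`, written on the right of its argument: `x (ad v) = [x, v]`. -/
def rad (v : LieCompletion R L) : LieCompletion R L →ₗ[R] LieCompletion R L where
  toFun x := ⁅x, v⁆
  map_add' x y := add_lie x y v
  map_smul' c x := smul_lie c x v

@[simp] theorem rad_apply (v x : LieCompletion R L) : rad v x = ⁅x, v⁆ := rfl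

/-- A family whose image in each `L / L^{k+1}` has finite support is summable. -/
theorem summable_of_finite {ι : Type*} (f : ι → LieCompletion R L)
    (hf : ∀ k, {i | proj k (f i) ≠ 0}.Finite) : Summable f := by
  classical
  have key : ∀ k (s : Finset ι), (hf k).toFinset ⊆ s →
      ∑ i ∈ s, proj k (f i) = ∑ i ∈ (hf k).toFinset, proj k (f i) := by
    intro k s hs
    refine (Finset.sum_subset hs ?_).symm
    intro i _ hi
    by_contra h
    exact hi ((hf k).mem_toFinset.2 h)
  have psum : ∀ k (s : Finset ι), proj k (∑ i ∈ s, f i) = ∑ i ∈ s, proj k (f i) := by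
    intro k s
    induction s using Finset.induction_on with
    | empty => simp
    | insert a s ha ih => rw [Finset.sum_insert ha, Finset.sum_insert ha, proj_add, ih]
  refine ⟨⟨fun k => ∑ i ∈ (hf k).toFinset, proj k (f i), ?_⟩, ?_⟩
  · intro k a ha
    have h := (∑ i ∈ (hf k).toFinset ∪ (hf (k + 1)).toFinset, f i).2 k a
    change _ = proj (k + 1) _ → _ = proj k _ at h
    rw [psum, psum, key k _ Finset.subset_union_left,
      key (k + 1) _ Finset.subset_union_right] at h
    exact h ha
  · rw [HasSum, nhds_iInf, Filter.tendsto_iInf]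
    intro k
    let _ : TopologicalSpace (L ⧸ LieModule.lowerCentralSeries R L L k) := ⊥
    rw [nhds_induced, Filter.tendsto_comap_iff]
    refine tendsto_nhds_of_eventually_eq ?_
    filter_upwards [Filter.eventually_ge_atTop (hf k).toFinset] with s hs
    rw [Function.comp_apply, psum, key k s hs]
    rfl

/-- The formal power series topology is Hausdorff, so sums of series are unique. -/
instance : T2Space (LieCompletion R L) := by
  refine ⟨fun x y hxy => ?_⟩
  obtain ⟨k, hk⟩ : ∃ k, proj k x ≠ proj k y := by
    by_contra! h
    exact hxy (LieCompletion.ext h)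
  have ho : ∀ s : Set (L ⧸ LieModule.lowerCentralSeries R L L k),
      IsOpen ((proj k : LieCompletion R L → _) ⁻¹' s) := fun s =>
    (iInf_le (fun k : ℕ => TopologicalSpace.induced (proj (R := R) (L := L) k) ⊥) k) _
      ⟨s, trivial, rfl⟩
  exact ⟨proj k ⁻¹' {proj k x}, proj k ⁻¹' {proj k y}, ho _, ho _, rfl, rfl,
    Set.disjoint_left.2 fun z hz hz' => hk (hz.symm.trans hz')⟩

/-- The bracket with any element raises the filtration degree. -/
theorem proj_lie_mem {n k : ℕ} {x v : LieCompletion R L}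
    (hx : ∃ a ∈ LieModule.lowerCentralSeries R L L n, LieSubmodule.Quotient.mk a = proj k x) :
    ∃ a ∈ LieModule.lowerCentralSeries R L L (n + 1),
      LieSubmodule.Quotient.mk a = proj k (rad v x) := by
  obtain ⟨a, ha, hax⟩ := hx
  obtain ⟨b, hb⟩ := LieSubmodule.Quotient.surjective_mk' _ (proj k v)
  refine ⟨⁅a, b⁆, ?_, ?_⟩
  · rw [← lie_skew, LieModule.lowerCentralSeries_succ]
    exact neg_mem (LieSubmodule.lie_mem_lie (LieSubmodule.mem_top b) ha)
  · rw [LieSubmodule.Quotient.mk_bracket, hax]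
    exact congrArg _ hb

theorem proj_rad_pow_mem {n k : ℕ} {x : LieCompletion R L} (v : LieCompletion R L) (j : ℕ)
    (hx : ∃ a ∈ LieModule.lowerCentralSeries R L L n, LieSubmodule.Quotient.mk a = proj k x) :
    ∃ a ∈ LieModule.lowerCentralSeries R L L (n + j),
      LieSubmodule.Quotient.mk a = proj k ((rad v ^ j) x) := by
  induction j with
  | zero => simpa using hx
  | succ j ih =>
    rw [pow_succ']
    exact proj_lie_mem ih

/-- `x (ad p)^a (ad q)^b` vanishes modulo `L^{k+1}` as soon as `a + b ≥ k`. -/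
theorem proj_rad_pow_rad_pow {k a b : ℕ} (h : k ≤ a + b) (p q x : LieCompletion R L) :
    proj k ((rad q ^ b) ((rad p ^ a) x)) = 0 := by
  obtain ⟨c, hc⟩ := LieSubmodule.Quotient.surjective_mk' _ (proj k x)
  have h0 : ∃ a ∈ LieModule.lowerCentralSeries R L L 0,
      LieSubmodule.Quotient.mk a = proj k x := ⟨c, by simp, hc⟩
  obtain ⟨d, hd, hd'⟩ := proj_rad_pow_mem q b (proj_rad_pow_mem p a h0)
  rw [← hd', LieSubmodule.Quotient.mk_eq_zero']
  exact LieModule.antitone_lowerCentralSeries R L L (by omega) hd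

/-- The value `x f(ad p, ad q) = ∑_{a,b} f_{ab} x (ad p)^a (ad q)^b` of a formal power series
`f ∈ R[[t₁, t₂]]`, as a sum in the formal power series topology. -/
def applySeries (f : MvPowerSeries (Fin 2) R) (p q x : LieCompletion R L) : LieCompletion R L :=
  ∑' e : Fin 2 →₀ ℕ, MvPowerSeries.coeff e f • (rad q ^ e 1) ((rad p ^ e 0) x)

/-- The series defining `applySeries` always converges. -/
theorem summable_applySeries (f : MvPowerSeries (Fin 2) R) (p q x : LieCompletion R L) :
    Summable fun e : Fin 2 →₀ ℕ =>
      MvPowerSeries.coeff e f • (rad q ^ e 1) ((rad p ^ e 0) x) := by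
  refine summable_of_finite _ fun k => ?_
  refine (Finsupp.finite_of_degree_le (σ := Fin 2) k).subset ?_
  intro e he
  by_contra hk
  refine he ?_
  rw [Set.mem_ofPred_eq, not_le, Finsupp.degree_eq_sum, Fin.sum_univ_two] at hk
  rw [proj_smul, proj_rad_pow_rad_pow hk.le, smul_zero]

end General

section Exp

variable {K L : Type*} [Field K] [LieRing L] [LieAlgebra K L]

/-- The operator `exp (ad v) = ∑_n (ad v)^n / n!`, as a sum in the formal power series topology. -/
def expAd (v x : LieCompletion K L) : LieCompletion K L :=
  ∑' n : ℕ, ((n.factorial : K)⁻¹) • (rad v ^ n) x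

/-- The exponential series of `ad v` always converges. -/
theorem summable_expAd (v x : LieCompletion K L) :
    Summable fun n : ℕ => ((n.factorial : K)⁻¹) • (rad v ^ n) x := by
  refine summable_of_finite _ fun k => (Set.finite_lt_nat k).subset ?_
  intro n hn
  by_contra hk
  refine hn ?_
  have h := proj_rad_pow_rad_pow (k := k) (a := 0) (b := n) (by simpa using hk) 0 v x
  rw [pow_zero] at h
  rw [proj_smul]
  exact (congrArg _ h).trans (smul_zero _)

end Exp

end LieCompletion

/-! ### The free metabelian Lie algebra and the linear component -/

/-- The free metabelian Lie algebra `F_m = L_m / L_m''` of rank `m`. -/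
abbrev FreeMetabelian (K : Type*) [CommRing K] (m : ℕ) : Type _ :=
  FreeLieAlgebra K (Fin m) ⧸ LieAlgebra.derivedSeries K (FreeLieAlgebra K (Fin m)) 2

namespace FreeMetabelian

variable (K : Type*) [CommRing K] (m : ℕ)

/-- The free generators `y_1, …, y_m` of `F_m`. -/
def gen (i : Fin m) : FreeMetabelian K m :=
  LieSubmodule.Quotient.mk (FreeLieAlgebra.of K i)

/-- The completion of `F_m` in the formal power series topology. -/
abbrev Hat : Type _ := LieCompletion K (FreeMetabelian K m)

section

attribute [local instance 100] LieRing.ofAssociativeRing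

/-- The Lie algebra map `L_m → K` to the abelian Lie algebra `K` which sends the `i`-th generator
to `1` and the others to `0`: it reads off the coefficient of `x_i`. -/
def freeCoord (i : Fin m) : FreeLieAlgebra K (Fin m) →ₗ[K] K :=
  (FreeLieAlgebra.lift K (fun j : Fin m => if j = i then (1 : K) else 0) :
    FreeLieAlgebra K (Fin m) →ₗ⁅K⁆ K)

theorem freeCoord_of (i j : Fin m) :
    freeCoord K m i (FreeLieAlgebra.of K j) = if j = i then 1 else 0 :=
  FreeLieAlgebra.lift_of_apply _ _

theorem freeCoord_lie (i : Fin m) (a b : FreeLieAlgebra K (Fin m)) :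
    freeCoord K m i ⁅a, b⁆ = 0 := by
  have h := LieHom.map_lie (FreeLieAlgebra.lift K (fun j : Fin m => if j = i then (1 : K) else 0))
    a b
  refine h.trans ?_
  rw [LieRing.of_associative_ring_bracket, mul_comm, sub_self]

end

/-- The coefficient of `y_i` in an element of `F_m`. -/
def coord (i : Fin m) : FreeMetabelian K m →ₗ[K] K :=
  Submodule.liftQ
    (LieAlgebra.derivedSeries K (FreeLieAlgebra K (Fin m)) 2).toSubmodule (freeCoord K m i) (by
      have h : LieAlgebra.derivedSeries K (FreeLieAlgebra K (Fin m)) 2 ≤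
          ⁅(⊤ : LieIdeal K (FreeLieAlgebra K (Fin m))),
            (⊤ : LieIdeal K (FreeLieAlgebra K (Fin m)))⁆ := by
        rw [LieAlgebra.derivedSeries, LieAlgebra.derivedSeriesOfIdeal_succ]
        exact LieSubmodule.mono_lie le_top le_top
      intro x hx
      have hx' := h hx
      rw [← LieSubmodule.mem_toSubmodule, LieSubmodule.lieIdeal_oper_eq_linear_span'] at hx'
      refine (Submodule.span_le (p := LinearMap.ker (freeCoord K m i))).2 ?_ hx'
      rintro _ ⟨a, _, b, _, rfl⟩
      exact freeCoord_lie K m i a b)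

theorem coord_gen (i j : Fin m) : coord K m i (gen K m j) = if j = i then 1 else 0 :=
  freeCoord_of K m i j

theorem coord_lie (i : Fin m) (a b : FreeMetabelian K m) : coord K m i ⁅a, b⁆ = 0 := by
  obtain ⟨a, rfl⟩ := LieSubmodule.Quotient.surjective_mk' _ a
  obtain ⟨b, rfl⟩ := LieSubmodule.Quotient.surjective_mk' _ b
  exact freeCoord_lie K m i a b

/-- The coefficient of `y_i` only depends on the class in `F_m / F_m^2`. -/
def coordQuot (i : Fin m) :
    (FreeMetabelian K m ⧸
      LieModule.lowerCentralSeries K (FreeMetabelian K m) (FreeMetabelian K m) 1) →ₗ[K] K :=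
  Submodule.liftQ
    (LieModule.lowerCentralSeries K (FreeMetabelian K m) (FreeMetabelian K m) 1).toSubmodule
    (coord K m i) (by
      intro x hx
      rw [LieModule.lowerCentralSeries_succ, LieSubmodule.lieIdeal_oper_eq_linear_span'] at hx
      refine (Submodule.span_le (p := LinearMap.ker (coord K m i))).2 ?_ hx
      rintro _ ⟨a, _, b, _, rfl⟩
      exact coord_lie K m i a b)

variable {K m}

/-- The linear component `ū = ∑ c_i y_i` of `u`. -/
def linPart (u : Hat K m) : Hat K m :=
  ∑ i : Fin m, coordQuot K m i (LieCompletion.proj 1 u) • LieCompletion.ofLie (gen K m i)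

/-- The component `u₀ = u - ū`. -/
def comPart (u : Hat K m) : Hat K m := u - linPart u

/-- `u₀` lies in the completed commutator ideal: its class in `F_m / F_m^2` is zero. -/
theorem proj_one_comPart (u : Hat K m) : LieCompletion.proj 1 (comPart u) = 0 := by
  let Q := FreeMetabelian K m ⧸
    LieModule.lowerCentralSeries K (FreeMetabelian K m) (FreeMetabelian K m) 1
  have hab : ∀ a b : Q, ⁅a, b⁆ = 0 := by
    intro a b
    obtain ⟨a, rfl⟩ := LieSubmodule.Quotient.surjective_mk' _ a
    obtain ⟨b, rfl⟩ := LieSubmodule.Quotient.surjective_mk' _ b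
    refine LieSubmodule.Quotient.mk_eq_zero'.2 ?_
    exact LieSubmodule.lie_mem_lie (LieSubmodule.mem_top a) (LieSubmodule.mem_top b)
  let g : Fin m → Q := fun i => LieSubmodule.Quotient.mk (gen K m i)
  let f₁ : FreeLieAlgebra K (Fin m) →ₗ⁅K⁆ Q :=
    { toFun := fun a => LieSubmodule.Quotient.mk (LieSubmodule.Quotient.mk a)
      map_add' := fun _ _ => rfl
      map_smul' := fun _ _ => rfl
      map_lie' := rfl }
  let f₂ : FreeLieAlgebra K (Fin m) →ₗ⁅K⁆ Q :=
    { toFun := fun a => ∑ i, freeCoord K m i a • g i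
      map_add' := fun a b => by simp [add_smul, Finset.sum_add_distrib]
      map_smul' := fun c a => by simp [Finset.smul_sum, mul_smul]
      map_lie' := by
        intro a b
        rw [hab]
        simp [freeCoord_lie] }
  have hf : f₁ = f₂ := by
    refine FreeLieAlgebra.hom_ext fun j => ?_
    change g j = ∑ i, freeCoord K m i (FreeLieAlgebra.of K j) • g i
    simp [freeCoord_of]
  have hu : LieCompletion.proj 1 (linPart u) =
      ∑ i, coordQuot K m i (LieCompletion.proj 1 u) • g i := by
    have psum : ∀ s : Finset (Fin m), LieCompletion.proj 1
        (∑ i ∈ s, coordQuot K m i (LieCompletion.proj 1 u) • LieCompletion.ofLie (gen K m i)) =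
        ∑ i ∈ s, coordQuot K m i (LieCompletion.proj 1 u) • g i := by
      classical
      intro s
      induction s using Finset.induction_on with
      | empty => simp
      | insert a s ha ih =>
        rw [Finset.sum_insert ha, Finset.sum_insert ha, LieCompletion.proj_add, ih]
        rfl
    exact psum _
  have hsub : LieCompletion.proj 1 (comPart u) =
      LieCompletion.proj 1 u - LieCompletion.proj 1 (linPart u) := rfl
  rw [hsub, hu]
  obtain ⟨a, ha⟩ := LieSubmodule.Quotient.surjective_mk' _ (LieCompletion.proj 1 u)
  obtain ⟨a, rfl⟩ := LieSubmodule.Quotient.surjective_mk' _ a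
  rw [← ha, sub_eq_zero]
  exact LieHom.congr_fun hf a

end FreeMetabelian

/-! ### The power series `c` -/

namespace MetabelianBCH

set_option linter.unusedSectionVars false

variable (K : Type*) [Field K] [CharZero K]

/-- `h(t) = (e^t - 1) / t`, that is `∑_n t^n / (n+1)!`. -/
def hSeries : PowerSeries K := PowerSeries.mk fun n => (((n + 1).factorial : K)⁻¹)

theorem X_mul_hSeries : PowerSeries.X * hSeries K = PowerSeries.exp K - 1 := by
  ext n
  cases n with
  | zero => simp
  | succ n => simp [PowerSeries.coeff_succ_X_mul, hSeries, PowerSeries.coeff_exp,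
      PowerSeries.coeff_one]

/-- The numerator `e^{t₂} h(t₁) - h(t₂)`. -/
def numer : MvPowerSeries (Fin 2) K :=
  (PowerSeries.exp K).subst (MvPowerSeries.X 1 : MvPowerSeries (Fin 2) K) *
      (hSeries K).subst (MvPowerSeries.X 0 : MvPowerSeries (Fin 2) K) -
    (hSeries K).subst (MvPowerSeries.X 1 : MvPowerSeries (Fin 2) K)

/-- The denominator `e^{t₁ + t₂} - 1`. -/
def denom : MvPowerSeries (Fin 2) K :=
  (PowerSeries.exp K).subst
    (MvPowerSeries.X 0 + MvPowerSeries.X 1 : MvPowerSeries (Fin 2) K) - 1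

theorem denom_eq : denom K = (MvPowerSeries.X 0 + MvPowerSeries.X 1) *
    (hSeries K).subst (MvPowerSeries.X 0 + MvPowerSeries.X 1 : MvPowerSeries (Fin 2) K) := by
  have hs : PowerSeries.HasSubst
      (MvPowerSeries.X 0 + MvPowerSeries.X 1 : MvPowerSeries (Fin 2) K) :=
    (PowerSeries.HasSubst.X 0).add (PowerSeries.HasSubst.X 1)
  have h := congrArg (PowerSeries.substAlgHom (R := K) hs) (X_mul_hSeries K)
  rw [map_mul, map_sub, map_one, PowerSeries.coe_substAlgHom, PowerSeries.subst_X hs] at h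
  exact h.symm

theorem constantCoeff_hSeries_subst : MvPowerSeries.constantCoeff
    ((hSeries K).subst (MvPowerSeries.X 0 + MvPowerSeries.X 1 : MvPowerSeries (Fin 2) K)) = 1 := by
  have hs : PowerSeries.HasSubst
      (MvPowerSeries.X 0 + MvPowerSeries.X 1 : MvPowerSeries (Fin 2) K) :=
    (PowerSeries.HasSubst.X 0).add (PowerSeries.HasSubst.X 1)
  rw [PowerSeries.constantCoeff_subst hs, finsum_eq_single _ 0]
  · simp [hSeries]
  · intro n hn
    simp [hn]

theorem coeff_exp_mul_hSeries (e : Fin 2 →₀ ℕ) : MvPowerSeries.coeff e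
    ((PowerSeries.exp K).subst (MvPowerSeries.X 1 : MvPowerSeries (Fin 2) K) *
      (hSeries K).subst (MvPowerSeries.X 0 : MvPowerSeries (Fin 2) K)) =
    ((e 1).factorial : K)⁻¹ * ((e 0 + 1).factorial : K)⁻¹ := by
  classical
  rw [MvPowerSeries.coeff_mul,
    Finset.sum_eq_single (Finsupp.single 1 (e 1), Finsupp.single 0 (e 0))]
  · rw [PowerSeries.coeff_subst_single, PowerSeries.coeff_subst_single]
    simp [hSeries, PowerSeries.coeff_exp]
  · rintro ⟨p, q⟩ hpq hne
    rw [PowerSeries.coeff_subst_single, PowerSeries.coeff_subst_single]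
    dsimp only
    split_ifs with h1 h2
    · exfalso
      apply hne
      rw [Finset.HasAntidiagonal.mem_antidiagonal] at hpq
      dsimp only at hpq
      rw [← hpq, h1, h2]
      simp
    · simp
    · simp
    · simp
  · intro h
    exfalso
    apply h
    rw [Finset.HasAntidiagonal.mem_antidiagonal]
    ext i
    fin_cases i <;> simp

/-- The numerator is divisible by `t₁ + t₂`. -/
theorem dvd_numer : (MvPowerSeries.X 0 + MvPowerSeries.X 1 : MvPowerSeries (Fin 2) K) ∣ numer K := by
  classical
  let q : MvPowerSeries (Fin 2) K := fun e =>
    ((e 0 + e 1 + 1).choose (e 0 + 1) : K) * ((e 0 + e 1 + 2).factorial : K)⁻¹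
  have hq : ∀ e : Fin 2 →₀ ℕ, MvPowerSeries.coeff e q =
    ((e 0 + e 1 + 1).choose (e 0 + 1) : K) * ((e 0 + e 1 + 2).factorial : K)⁻¹ := fun e => rfl
  refine ⟨q, ?_⟩
  ext e
  rw [numer, map_sub, coeff_exp_mul_hSeries, PowerSeries.coeff_subst_single, add_mul, map_add,
    MvPowerSeries.X, MvPowerSeries.X, MvPowerSeries.coeff_monomial_mul,
    MvPowerSeries.coeff_monomial_mul, hq, hq]
  have he : e = Finsupp.single 1 (e 1) ↔ e 0 = 0 := by
    constructor
    · intro h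
      rw [h]
      simp
    · intro h
      ext i
      fin_cases i <;> simp [h]
  simp only [he, Finsupp.single_le_iff, Finsupp.tsub_apply, one_mul]
  simp only [Finsupp.single_apply, hSeries, PowerSeries.coeff_mk]
  generalize e 0 = a
  generalize e 1 = b
  have hfac : ∀ n : ℕ, (n.factorial : K) ≠ 0 := fun n => Nat.cast_ne_zero.2 n.factorial_ne_zero
  rcases a with _ | a <;> rcases b with _ | b
  · simp
  · have h1 := hfac (b + 1)
    have h2 : ((b + 2).factorial : K) = (b + 2) * ((b + 1).factorial : K) := by
      rw [Nat.factorial_succ]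
      push_cast
      ring
    have h3 := hfac (b + 2)
    have h4 : (b + 2 : K) ≠ 0 := by
      rw [h2] at h3
      exact left_ne_zero_of_mul h3
    simp [h2]
    field_simp
    ring
  · simp
  · have h1 : ((a + (b + 1) + 1).choose (a + 1) : K) + ((a + 1 + b + 1).choose (a + 1 + 1) : K) =
        ((a + 1 + (b + 1) + 1).choose (a + 1 + 1) : K) := by
      have e1 : a + (b + 1) + 1 = a + b + 2 := by omega
      have e2 : a + 1 + b + 1 = a + b + 2 := by omega
      have e3 : a + 1 + (b + 1) + 1 = (a + b + 2) + 1 := by omega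
      rw [e1, e2, e3, Nat.choose_succ_succ (a + b + 2) (a + 1)]
      push_cast
      ring
    have h2 : ((a + 1 + (b + 1) + 1).choose (a + 1 + 1) : K) * ((a + 1 + 1).factorial : K) *
        ((b + 1).factorial : K) = ((a + 1 + (b + 1) + 1).factorial : K) := by
      have h := Nat.choose_mul_factorial_mul_factorial
        (show a + 1 + 1 ≤ a + 1 + (b + 1) + 1 by omega)
      rw [show a + 1 + (b + 1) + 1 - (a + 1 + 1) = b + 1 by omega] at h
      exact_mod_cast h
    have h3 := hfac (a + 1 + 1)
    have h4 := hfac (b + 1)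
    have h5 := hfac (a + 1 + (b + 1) + 1)
    have e1 : a + (b + 1) + 2 = a + 1 + (b + 1) + 1 := by omega
    have e2 : a + 1 + b + 2 = a + 1 + (b + 1) + 1 := by omega
    simp only [if_true, Nat.add_sub_cancel, Nat.le_add_left, Nat.add_eq_zero_iff, one_ne_zero,
      zero_ne_one, and_false, if_false, Nat.sub_zero, sub_zero, e1, e2, ← add_mul, h1]
    rw [← h2] at h5 ⊢
    have h6 := left_ne_zero_of_mul (left_ne_zero_of_mul h5)
    field_simp

/-- The power series `c(t₁, t₂)` exists: after cancelling `t₁ + t₂`, the denominator is a unit. -/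
theorem exists_cSeries : ∃ c : MvPowerSeries (Fin 2) K, c * denom K = numer K := by
  obtain ⟨q, hq⟩ := dvd_numer K
  refine ⟨q * ((hSeries K).subst
    (MvPowerSeries.X 0 + MvPowerSeries.X 1 : MvPowerSeries (Fin 2) K))⁻¹, ?_⟩
  have h : MvPowerSeries.constantCoeff ((hSeries K).subst
      (MvPowerSeries.X 0 + MvPowerSeries.X 1 : MvPowerSeries (Fin 2) K)) ≠ 0 := by
    rw [constantCoeff_hSeries_subst]
    exact one_ne_zero
  rw [denom_eq, hq, mul_comm (MvPowerSeries.X 0 + MvPowerSeries.X 1), mul_assoc,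
    ← mul_assoc _ _ (MvPowerSeries.X 0 + MvPowerSeries.X 1), MvPowerSeries.inv_mul_cancel _ h,
    one_mul, mul_comm]

/-- The power series `c(t₁, t₂) = (e^{t₂} h(t₁) - h(t₂)) / (e^{t₁ + t₂} - 1)`; the quotient is
unique because `K[[t₁, t₂]]` is a domain and the denominator is not zero. -/
def cSeries : MvPowerSeries (Fin 2) K := (exists_cSeries K).choose

theorem cSeries_mul_denom : cSeries K * denom K = numer K := (exists_cSeries K).choose_spec

theorem denom_ne_zero : denom K ≠ 0 := by
  classical
  rw [denom_eq]
  refine mul_ne_zero ?_ ?_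
  · intro h
    have h1 := congrArg (MvPowerSeries.coeff (Finsupp.single (0 : Fin 2) 1)) h
    simp [MvPowerSeries.coeff_X, Finsupp.single_left_inj] at h1
  · intro h
    have h1 := constantCoeff_hSeries_subst K
    rw [h, map_zero] at h1
    exact zero_ne_one h1

theorem eq_cSeries {c : MvPowerSeries (Fin 2) K} (h : c * denom K = numer K) : c = cSeries K :=
  mul_right_cancel₀ (denom_ne_zero K) (h.trans (cSeries_mul_denom K).symm)

variable {K} {L : Type*} [LieRing L] [LieAlgebra K L]

/-- `H(p, q) = p + q + [p, q] c(ad p, ad q)`. -/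
def H (p q : LieCompletion K L) : LieCompletion K L :=
  p + q + LieCompletion.applySeries (cSeries K) p q ⁅p, q⁆

end MetabelianBCH

end

/-!
Write `F` for the completed free metabelian Lie algebra and `F'` for its completed commutator
ideal, which is abelian.  The theorem has two halves: the given `w` satisfies the equation, and an
element `w` is determined by `exp (ad w)`.

**Existence.**  As `F'` is abelian, the operators `ad u` and `ad v` commute on it, so `F'` is a
module over `K[[t₁, t₂]]` (`LieCompletion.mul_applySeries`), for which `ad x : F' → F'` is linear
for every `x` in `F` (`LieCompletion.lie_applySeries`).  Only the classes of `u` and `v` modulo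
`F'` matter for this module structure, so the stated `w` is just
`H(u, v) = u + v + [u, v] c(ad u, ad v)` (`FreeMetabelian.H_eq`).  On `F'` the operator `ad w` is
multiplication by `t₁ + t₂`, and `x exp(ad z) = x + [x, z] h(ad z)` for all `x` and `z`.  Hence both
sides of `exp(ad u) exp(ad v) = exp(ad w)`, applied to `x`, are `x` plus a combination of `[x, u]`
and `[x, v]` with coefficients in `K[[t₁, t₂]]`, and the coefficients agree by the identities
`(1 + t₂ c) h(t₁ + t₂) = e^{t₂} h(t₁)` and `(1 - t₁ c) h(t₁ + t₂) = h(t₂)`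
(`LieCompletion.expAd_expAd`).

**Uniqueness.**  Let `exp(ad w) = exp(ad w')` and suppose that `d = w - w'` has filtration degree
`k`, that is, lies in the closure of `F_m^{k+1}`.  The terms of order at least two of
the two exponentials differ by operators which raise the degree by at least `k + 2`, hence so does
`ad d`.  It remains to see that `d` has degree `k + 1`
(`LieCompletion.eq_of_expAd_eq`), that is, that the associated graded Lie algebra of the free
metabelian Lie algebra has trivial center (`mem_lowerCentralSeries_of_lie_mem`).  For this the
Magnus representation `y_i ↦ t_i + e_i` into the wreath product `S ⋉ S^m`, `S = K[t_1, …, t_m]`,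
is used.  It restricts to an `S`-linear map from the commutator ideal to the free module `S^m`, where
multiplication by `t_i` is injective.  No basis of the free metabelian Lie algebra is needed to see
that nothing is lost: by Euler's identity and the Jacobi identity, the contraction
`∑ p_i e_i ↦ ∑ [y_j, y_i] ∂_j p_i` inverts the Magnus map on commutators of degree `n` up to the
factor `n` (`contract_snd_map`), and `n` is invertible in `K`.
-/

noncomputable section

section MagnusEmbedding

open MvPolynomial

/-! ### The Magnus representation of the free metabelian Lie algebra -/

/-- The abelian wreath product `S ⋉ S^σ` over the polynomial ring `S = K[t_i : i ∈ σ]`, with bracket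
`[(f, p), (g, q)] = (0, f q - g p)`.  It is the Lie analogue of the target of the Magnus
representation of a free metabelian group. -/
def MagnusLie (K σ : Type*) [CommRing K] : Type _ :=
  MvPolynomial σ K × (σ → MvPolynomial σ K)

namespace MagnusLie

variable {K σ : Type*} [CommRing K]

instance : AddCommGroup (MagnusLie K σ) :=
  inferInstanceAs (AddCommGroup (MvPolynomial σ K × (σ → MvPolynomial σ K)))

instance : Module K (MagnusLie K σ) :=
  inferInstanceAs (Module K (MvPolynomial σ K × (σ → MvPolynomial σ K)))

instance : Bracket (MagnusLie K σ) (MagnusLie K σ) where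
  bracket x y := (0, x.1 • y.2 - y.1 • x.2)

theorem ext {x y : MagnusLie K σ} (h₁ : x.1 = y.1) (h₂ : ∀ i, x.2 i = y.2 i) : x = y :=
  Prod.ext h₁ (funext h₂)

@[simp] theorem fst_add (x y : MagnusLie K σ) : (x + y).1 = x.1 + y.1 := rfl
@[simp] theorem snd_add (x y : MagnusLie K σ) : (x + y).2 = x.2 + y.2 := rfl
@[simp] theorem fst_zero : (0 : MagnusLie K σ).1 = 0 := rfl
@[simp] theorem snd_zero : (0 : MagnusLie K σ).2 = 0 := rfl
@[simp] theorem fst_smul (c : K) (x : MagnusLie K σ) : (c • x).1 = c • x.1 := rfl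
@[simp] theorem snd_smul (c : K) (x : MagnusLie K σ) : (c • x).2 = c • x.2 := rfl
@[simp] theorem fst_lie (x y : MagnusLie K σ) : ⁅x, y⁆.1 = 0 := rfl
@[simp] theorem snd_lie (x y : MagnusLie K σ) : ⁅x, y⁆.2 = x.1 • y.2 - y.1 • x.2 := rfl

instance : LieRing (MagnusLie K σ) where
  add_lie x y z := by
    refine ext (by simp) fun i => ?_
    simp only [snd_lie, snd_add, fst_add, Pi.sub_apply, Pi.smul_apply, Pi.add_apply, smul_eq_mul]
    ring
  lie_add x y z := by
    refine ext (by simp) fun i => ?_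
    simp only [snd_lie, snd_add, fst_add, Pi.sub_apply, Pi.smul_apply, Pi.add_apply, smul_eq_mul]
    ring
  lie_self x := by
    refine ext (by simp) fun i => ?_
    simp
  leibniz_lie x y z := by
    refine ext (by simp) fun i => ?_
    simp only [snd_lie, snd_add, fst_lie, Pi.sub_apply, Pi.smul_apply, Pi.add_apply, smul_eq_mul]
    ring

instance : LieAlgebra K (MagnusLie K σ) where
  lie_smul c x y := by
    refine ext (by simp) fun i => ?_
    simp [smul_sub]

/-- The elements `t_i + e_i`, the images of the free generators. -/
def gen [DecidableEq σ] (i : σ) : MagnusLie K σ := (X i, Pi.single i 1)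

@[simp] theorem fst_gen [DecidableEq σ] (i : σ) : (gen i : MagnusLie K σ).1 = X i := rfl
@[simp] theorem snd_gen [DecidableEq σ] (i : σ) :
    (gen i : MagnusLie K σ).2 = Pi.single i 1 := rfl

end MagnusLie

/-! ### Lie-theoretic preliminaries -/

section Preliminaries

variable {K L : Type*} [CommRing K] [LieRing L] [LieAlgebra K L]

theorem lie_mem_lowerCentralSeries_succ {k : ℕ} (a : L) {b : L}
    (hb : b ∈ LieModule.lowerCentralSeries K L L k) :
    ⁅a, b⁆ ∈ LieModule.lowerCentralSeries K L L (k + 1) := by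
  rw [LieModule.lowerCentralSeries_succ]
  exact LieSubmodule.lie_mem_lie (LieSubmodule.mem_top a) hb

theorem lie_mem_lowerCentralSeries_one (a b : L) :
    ⁅a, b⁆ ∈ LieModule.lowerCentralSeries K L L 1 :=
  lie_mem_lowerCentralSeries_succ a (by simp)

/-- To be contained in a submodule, it suffices for a term of the lower central series that the
submodule contains the brackets which span it. -/
theorem lowerCentralSeries_succ_le {k : ℕ} {N : Submodule K L}
    (h : ∀ a : L, ∀ b ∈ LieModule.lowerCentralSeries K L L k, ⁅a, b⁆ ∈ N) {x : L}
    (hx : x ∈ LieModule.lowerCentralSeries K L L (k + 1)) : x ∈ N := by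
  rw [LieModule.lowerCentralSeries_succ, ← LieSubmodule.mem_toSubmodule,
    LieSubmodule.lieIdeal_oper_eq_linear_span'] at hx
  refine Submodule.span_le.2 ?_ hx
  rintro _ ⟨a, _, b, hb, rfl⟩
  exact h a b hb

/-- `[L^{i+1}, L^{j+1}] ⊆ L^{i+j+2}`, in the usual numbering of the lower central series. -/
theorem lie_mem_lowerCentralSeries {i j : ℕ} {a b : L}
    (ha : a ∈ LieModule.lowerCentralSeries K L L i)
    (hb : b ∈ LieModule.lowerCentralSeries K L L j) :
    ⁅a, b⁆ ∈ LieModule.lowerCentralSeries K L L (i + j + 1) := by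
  induction i generalizing j a b with
  | zero =>
    rw [zero_add]
    exact lie_mem_lowerCentralSeries_succ a hb
  | succ i ih =>
    rw [← lie_skew, neg_mem_iff]
    refine lowerCentralSeries_succ_le
      (N := (LieModule.lowerCentralSeries K L L (i + 1 + j + 1)).toSubmodule.comap
        (LieModule.toEnd K L L b)) (fun c d hd => ?_) ha
    rw [Submodule.mem_comap, LieModule.toEnd_apply_apply, leibniz_lie, LieSubmodule.mem_toSubmodule]
    refine add_mem ?_ ?_
    · rw [← lie_skew, neg_mem_iff]
      have h := ih hd (lie_mem_lowerCentralSeries_succ c hb)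
      rw [← lie_skew c b, lie_neg, neg_mem_iff] at h
      convert h using 2
      omega
    · have h := lie_mem_lowerCentralSeries_succ c (ih hd hb)
      rw [← lie_skew d b, lie_neg, neg_mem_iff] at h
      convert h using 2
      omega

/-- The evaluation of polynomials at a family of pairwise commuting elements of a
noncommutative algebra. -/
def aevalOfCommute {σ A : Type*} [Ring A] [Algebra K A] (T : σ → A)
    (hT : ∀ i j, T i * T j = T j * T i) : MvPolynomial σ K →ₐ[K] A :=
  letI : CommRing (Algebra.adjoin K (Set.range T)) :=
    { (inferInstance : Ring (Algebra.adjoin K (Set.range T))) with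
      mul_comm := (Algebra.isMulCommutative_adjoin K (by
        rintro _ ⟨i, rfl⟩ _ ⟨j, rfl⟩
        exact hT i j)).is_comm.comm }
  (Algebra.adjoin K (Set.range T)).val.comp
    (MvPolynomial.aeval fun i => ⟨T i, Algebra.subset_adjoin ⟨i, rfl⟩⟩)

@[simp] theorem aevalOfCommute_X {σ A : Type*} [Ring A] [Algebra K A] (T : σ → A)
    (hT : ∀ i j, T i * T j = T j * T i) (i : σ) : aevalOfCommute (K := K) T hT (X i) = T i := by
  simp [aevalOfCommute]

end Preliminaries

/-! ### Polynomials of bounded order -/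

section Order

variable {K σ : Type*} [CommRing K]

/-- The polynomials all of whose monomials have degree at least `n`. -/
def polyOrderGE (K σ : Type*) [CommRing K] (n : ℕ) : Submodule K (MvPolynomial σ K) where
  carrier := {f | ∀ e : σ →₀ ℕ, e.degree < n → coeff e f = 0}
  add_mem' := fun hf hg e he => by rw [coeff_add, hf e he, hg e he, add_zero]
  zero_mem' := fun e _ => coeff_zero e
  smul_mem' := fun c f hf e he => by rw [coeff_smul, hf e he, smul_zero]

theorem single_one_add_sub_single {e : σ →₀ ℕ} {i : σ} (hi : i ∈ e.support) :
    Finsupp.single i 1 + (e - Finsupp.single i 1) = e :=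
  add_tsub_cancel_of_le (Finsupp.single_le_iff.2
    (Nat.one_le_iff_ne_zero.2 (Finsupp.mem_support_iff.1 hi)))

theorem X_mul_mem_polyOrderGE_succ {n : ℕ} (i : σ) {f : MvPolynomial σ K} :
    X i * f ∈ polyOrderGE K σ (n + 1) ↔ f ∈ polyOrderGE K σ n := by
  classical
  constructor
  · intro h e he
    have h1 := h (Finsupp.single i 1 + e) (by
      rw [map_add, Finsupp.degree_single]
      omega)
    rwa [coeff_X_mul] at h1
  · intro h e he
    rw [coeff_X_mul']
    split_ifs with hi
    · refine h _ ?_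
      rw [← single_one_add_sub_single hi, map_add, Finsupp.degree_single] at he
      omega
    · rfl

theorem pderiv_mem_polyOrderGE {n : ℕ} (i : σ) {f : MvPolynomial σ K}
    (hf : f ∈ polyOrderGE K σ (n + 1)) : pderiv i f ∈ polyOrderGE K σ n := by
  classical
  intro e he
  rw [coeff_pderiv, hf _ (by rw [map_add, Finsupp.degree_single]; omega), zero_mul]

/-- A linear map on polynomials takes `polyOrderGE n` into `N` if it takes there the monomials of
degree at least `n`. -/
theorem map_mem_of_mem_polyOrderGE {V : Type*} [AddCommGroup V] [Module K V]
    (T : MvPolynomial σ K →ₗ[K] V) {N : Submodule K V} {n : ℕ}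
    (hT : ∀ e : σ →₀ ℕ, n ≤ e.degree → T (monomial e 1) ∈ N) {f : MvPolynomial σ K}
    (hf : f ∈ polyOrderGE K σ n) : T f ∈ N := by
  rw [f.as_sum, map_sum]
  refine sum_mem fun e he => ?_
  have h1 : (monomial e (coeff e f) : MvPolynomial σ K) = coeff e f • monomial e 1 := by
    rw [smul_monomial, smul_eq_mul, mul_one]
  rw [h1, map_smul]
  refine N.smul_mem _ (hT e ?_)
  by_contra h
  exact mem_support_iff.1 he (hf e (not_le.1 h))

end Order

/-! ### The commutator ideal as a module over the polynomial ring -/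

section CommutatorModule

variable {K σ L : Type*} [Field K] [LieRing L] [LieAlgebra K L]

/-- The action of `K[t_i : i ∈ σ]` on the commutator ideal of a metabelian Lie algebra in which
`t_i` acts as `ad (y i)`. -/
def polyAd (hmet : ∀ a ∈ LieModule.lowerCentralSeries K L L 1,
      ∀ b ∈ LieModule.lowerCentralSeries K L L 1, ⁅a, b⁆ = 0) (y : σ → L) :
    MvPolynomial σ K →ₐ[K] Module.End K (LieModule.lowerCentralSeries K L L 1) :=
  aevalOfCommute (fun i => LieModule.toEnd K L (LieModule.lowerCentralSeries K L L 1) (y i)) (by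
    intro i j
    ext a
    change ⁅y i, ⁅y j, (a : L)⁆⁆ = ⁅y j, ⁅y i, (a : L)⁆⁆
    rw [leibniz_lie, hmet _ (lie_mem_lowerCentralSeries_one _ _) _ a.2, zero_add])

/-- The commutator `[y_i, y_j]` as an element of the commutator ideal. -/
def genLie (K : Type*) {σ L : Type*} [Field K] [LieRing L] [LieAlgebra K L] (y : σ → L)
    (i j : σ) : LieModule.lowerCentralSeries K L L 1 :=
  ⟨⁅y i, y j⁆, lie_mem_lowerCentralSeries_one _ _⟩

variable (hmet : ∀ a ∈ LieModule.lowerCentralSeries K L L 1,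
      ∀ b ∈ LieModule.lowerCentralSeries K L L 1, ⁅a, b⁆ = 0) (y : σ → L)

theorem coe_polyAd_X_mul (i : σ) (f : MvPolynomial σ K)
    (a : LieModule.lowerCentralSeries K L L 1) :
    (polyAd hmet y (X i * f) a : L) = ⁅y i, (polyAd hmet y f a : L)⁆ := by
  rw [map_mul, polyAd, aevalOfCommute_X]
  rfl

theorem polyAd_monomial_mem (e : σ →₀ ℕ) (a : LieModule.lowerCentralSeries K L L 1) :
    (polyAd hmet y (monomial e 1) a : L) ∈ LieModule.lowerCentralSeries K L L (e.degree + 1) := by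
  obtain ⟨n, hn⟩ : ∃ n, e.degree = n := ⟨_, rfl⟩
  induction n generalizing e with
  | zero =>
    rw [Finsupp.degree_eq_zero_iff] at hn
    rw [hn, show (monomial (0 : σ →₀ ℕ) (1 : K)) = 1 from rfl, map_one]
    exact a.2
  | succ n ih =>
    obtain ⟨i, hi⟩ : e.support.Nonempty := by
      rw [Finsupp.support_nonempty_iff]
      rintro rfl
      simp at hn
    have h1 := single_one_add_sub_single hi
    have h2 : (e - Finsupp.single i 1).degree = n := by
      rw [← h1, map_add, Finsupp.degree_single] at hn
      omega
    have h3 : (monomial e (1 : K)) = X i * monomial (e - Finsupp.single i 1) 1 := by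
      rw [X, monomial_mul, h1, one_mul]
    rw [h3, coe_polyAd_X_mul, hn, ← h2]
    exact lie_mem_lowerCentralSeries_succ _ (ih _ h2)

/-- The span of the commutators `[y_i, y_j] t^e` with `|e| ≥ n`. -/
def commSpan (n : ℕ) : Submodule K L :=
  Submodule.span K {x | ∃ (e : σ →₀ ℕ) (i j : σ), n ≤ e.degree ∧
    x = polyAd hmet y (monomial e 1) (genLie K y i j)}

theorem commSpan_zero_le {x : L} (hx : x ∈ commSpan hmet y 0) :
    x ∈ LieModule.lowerCentralSeries K L L 1 := by
  refine (Submodule.span_le (p := (LieModule.lowerCentralSeries K L L 1).toSubmodule)).2 ?_ hx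
  rintro _ ⟨e, i, j, _, rfl⟩
  exact Subtype.prop _

theorem lie_gen_mem_commSpan {n : ℕ} (i : σ) {x : L} (hx : x ∈ commSpan hmet y n) :
    ⁅y i, x⁆ ∈ commSpan hmet y (n + 1) := by
  refine (Submodule.span_le (p := (commSpan hmet y (n + 1)).comap
    (LieModule.toEnd K L L (y i)))).2 ?_ hx
  rintro _ ⟨e, j, k, he, rfl⟩
  refine Submodule.subset_span ⟨Finsupp.single i 1 + e, j, k, ?_, ?_⟩
  · rw [map_add, Finsupp.degree_single]
    omega
  · rw [LieModule.toEnd_apply_apply, ← coe_polyAd_X_mul, X, monomial_mul, one_mul]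

theorem commSpan_antitone {n k : ℕ} (h : n ≤ k) : commSpan hmet y k ≤ commSpan hmet y n := by
  refine Submodule.span_mono ?_
  rintro _ ⟨e, i, j, he, rfl⟩
  exact ⟨e, i, j, h.trans he, rfl⟩

variable {y}

theorem lie_mem_commSpan_of_mem_span {n : ℕ} {v s : L} (hv : v ∈ Submodule.span K (Set.range y))
    (hs : s ∈ commSpan hmet y n) : ⁅v, s⁆ ∈ commSpan hmet y (n + 1) := by
  induction hv using Submodule.span_induction with
  | mem v hv =>
    obtain ⟨i, rfl⟩ := hv
    exact lie_gen_mem_commSpan hmet y i hs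
  | zero => simp
  | add a b _ _ ha hb => rw [add_lie]; exact add_mem ha hb
  | smul c a _ ha => rw [smul_lie]; exact Submodule.smul_mem _ _ ha

theorem add_lie_add_mem_commSpan {v w s t : L} (hv : v ∈ Submodule.span K (Set.range y))
    (hw : w ∈ Submodule.span K (Set.range y)) (hs : s ∈ commSpan hmet y 0)
    (ht : t ∈ commSpan hmet y 0) : ⁅v + s, w + t⁆ ∈ commSpan hmet y 0 := by
  have hvw : ⁅v, w⁆ ∈ commSpan hmet y 0 := by
    clear hs ht
    induction hv using Submodule.span_induction with
    | mem v hv =>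
      obtain ⟨i, rfl⟩ := hv
      induction hw using Submodule.span_induction with
      | mem w hw =>
        obtain ⟨j, rfl⟩ := hw
        refine Submodule.subset_span ⟨0, i, j, Nat.zero_le _, ?_⟩
        rw [show (monomial (0 : σ →₀ ℕ) (1 : K)) = 1 from rfl, map_one]
        rfl
      | zero => simp
      | add a b _ _ ha hb => rw [lie_add]; exact add_mem ha hb
      | smul c a _ ha => rw [lie_smul]; exact Submodule.smul_mem _ _ ha
    | zero => simp
    | add a b _ _ ha hb => rw [add_lie]; exact add_mem ha hb
    | smul c a _ ha => rw [smul_lie]; exact Submodule.smul_mem _ _ ha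
  have h0 := commSpan_antitone hmet y (Nat.zero_le 1)
  rw [add_lie, lie_add, lie_add,
    hmet s (commSpan_zero_le hmet y hs) t (commSpan_zero_le hmet y ht), add_zero, ← lie_skew s w]
  exact add_mem (add_mem hvw (h0 (lie_mem_commSpan_of_mem_span hmet hv ht)))
    (neg_mem (h0 (lie_mem_commSpan_of_mem_span hmet hw hs)))

/-- Modulo the commutators, every element is a linear combination of the generators. -/
theorem exists_add_commSpan (hgen : ∀ A : LieSubalgebra K L, (∀ i, y i ∈ A) → A = ⊤) (x : L) :
    ∃ v ∈ Submodule.span K (Set.range y), ∃ s ∈ commSpan hmet y 0, v + s = x := by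
  let A : LieSubalgebra K L :=
    { Submodule.span K (Set.range y) ⊔ commSpan hmet y 0 with
      lie_mem' := by
        intro a b ha hb
        obtain ⟨v, hv, s, hs, rfl⟩ := Submodule.mem_sup.1 ha
        obtain ⟨w, hw, t, ht, rfl⟩ := Submodule.mem_sup.1 hb
        exact Submodule.mem_sup_right (add_lie_add_mem_commSpan hmet hv hw hs ht) }
  have hx : x ∈ A := by
    rw [hgen A fun i => Submodule.mem_sup_left (Submodule.subset_span ⟨i, rfl⟩)]
    exact LieSubalgebra.mem_top x
  exact Submodule.mem_sup.1 hx

/-- The term `L^{n+2}` of the lower central series is spanned by the commutators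
`[y_i, y_j] t^e` with `|e| ≥ n`. -/
theorem mem_commSpan_of_mem_lowerCentralSeries
    (hgen : ∀ A : LieSubalgebra K L, (∀ i, y i ∈ A) → A = ⊤) {n : ℕ} {x : L}
    (hx : x ∈ LieModule.lowerCentralSeries K L L (n + 1)) : x ∈ commSpan hmet y n := by
  induction n generalizing x with
  | zero =>
    refine lowerCentralSeries_succ_le (fun a b _ => ?_) hx
    obtain ⟨v, hv, s, hs, rfl⟩ := exists_add_commSpan hmet hgen a
    obtain ⟨w, hw, t, ht, rfl⟩ := exists_add_commSpan hmet hgen b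
    exact add_lie_add_mem_commSpan hmet hv hw hs ht
  | succ n ih =>
    refine lowerCentralSeries_succ_le (fun a b hb => ?_) hx
    obtain ⟨v, hv, s, hs, rfl⟩ := exists_add_commSpan hmet hgen a
    rw [add_lie, hmet s (commSpan_zero_le hmet y hs) b
      (LieModule.antitone_lowerCentralSeries K L L (by omega) hb), add_zero]
    exact lie_mem_commSpan_of_mem_span hmet hv (ih hb)

end CommutatorModule

/-! ### Elements that centralize modulo a higher term of the lower central series -/

section Center

variable {K σ L : Type*} [Field K] [LieRing L] [LieAlgebra K L]
  (hmet : ∀ a ∈ LieModule.lowerCentralSeries K L L 1,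
      ∀ b ∈ LieModule.lowerCentralSeries K L L 1, ⁅a, b⁆ = 0) {y : σ → L}
  {φ : L →ₗ⁅K⁆ MagnusLie K σ}

theorem fst_map_eq_zero (φ : L →ₗ⁅K⁆ MagnusLie K σ) {a : L}
    (ha : a ∈ LieModule.lowerCentralSeries K L L 1) : (φ a).1 = 0 := by
  refine lowerCentralSeries_succ_le (N := LinearMap.ker
    ((LinearMap.fst K (MvPolynomial σ K) (σ → MvPolynomial σ K)).comp
      (φ : L →ₗ[K] MagnusLie K σ))) (fun a b _ => ?_) ha
  change (φ ⁅a, b⁆).1 = 0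
  rw [LieHom.map_lie, MagnusLie.fst_lie]

section

variable [DecidableEq σ]

theorem snd_map_lie_gen (hφ : ∀ i, φ (y i) = MagnusLie.gen i) (i : σ) {a : L}
    (ha : a ∈ LieModule.lowerCentralSeries K L L 1) :
    (φ ⁅y i, a⁆).2 = (X i : MvPolynomial σ K) • (φ a).2 := by
  rw [LieHom.map_lie, MagnusLie.snd_lie, hφ, fst_map_eq_zero φ ha, zero_smul, sub_zero,
    MagnusLie.fst_gen]

/-- The second Magnus coordinate is linear over the polynomial ring. -/
theorem snd_map_polyAd (hφ : ∀ i, φ (y i) = MagnusLie.gen i) (f : MvPolynomial σ K)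
    (a : LieModule.lowerCentralSeries K L L 1) :
    (φ (polyAd hmet y f a : L)).2 = f • (φ (a : L)).2 := by
  induction f using MvPolynomial.induction_on with
  | C c =>
    rw [← algebraMap_eq, AlgHom.commutes, algebraMap_smul]
    exact congrArg Prod.snd (map_smul φ c (a : L))
  | add p q hp hq =>
    rw [map_add, add_smul, ← hp, ← hq]
    exact congrArg Prod.snd (map_add φ (polyAd hmet y p a : L) (polyAd hmet y q a))
  | mul_X p i hp =>
    rw [mul_comm, coe_polyAd_X_mul, snd_map_lie_gen hφ i (Subtype.prop _), hp, mul_smul]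

theorem snd_map_genLie (hφ : ∀ i, φ (y i) = MagnusLie.gen i) (i j : σ) :
    (φ (genLie K y i j : L)).2 = Pi.single j (X i) - Pi.single i (X j) := by
  change (φ ⁅y i, y j⁆).2 = _
  rw [LieHom.map_lie, hφ, hφ]
  ext k : 1
  by_cases h1 : k = i <;> by_cases h2 : k = j <;> simp [Pi.single_apply, h1, h2]

end

/-- The contraction `∑ p_i e_i ↦ ∑_{i,j} [y_j, y_i] ∂_j p_i`, an inverse up to the degree of the
second Magnus coordinate on the commutator ideal. -/
def contract [Fintype σ] (y : σ → L) :
    (σ → MvPolynomial σ K) →ₗ[K] LieModule.lowerCentralSeries K L L 1 where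
  toFun p := ∑ i, ∑ j, polyAd hmet y (pderiv j (p i)) (genLie K y j i)
  map_add' p q := by simp [Finset.sum_add_distrib]
  map_smul' c p := by simp [Finset.smul_sum]

theorem contract_apply [Fintype σ] (p : σ → MvPolynomial σ K) : contract hmet y p =
    ∑ i, ∑ j, polyAd hmet y (pderiv j (p i)) (genLie K y j i) := rfl

theorem contract_single [Fintype σ] [DecidableEq σ] (i : σ) (f : MvPolynomial σ K) :
    contract hmet y (Pi.single i f) = ∑ j, polyAd hmet y (pderiv j f) (genLie K y j i) := by
  rw [contract_apply, Finset.sum_eq_single i]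
  · simp
  · intro k _ hk
    simp [hk]
  · simp

/-- The Jacobi identity for three generators, as a relation in the polynomial module. -/
theorem polyAd_X_genLie (i j l : σ) :
    polyAd hmet y (X i) (genLie K y l j) - polyAd hmet y (X j) (genLie K y l i) =
      polyAd hmet y (X l) (genLie K y i j) := by
  have h : ∀ i j l, (polyAd hmet y (X l) (genLie K y i j) : L) = ⁅y l, ⁅y i, y j⁆⁆ := by
    intro i j l
    rw [← mul_one (X l), coe_polyAd_X_mul, map_one]
    rfl
  ext
  rw [LieSubmodule.coe_sub, h, h, h, leibniz_lie (y l), ← lie_skew (y j) ⁅y l, y i⁆]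
  abel

/-- The contraction inverts the second Magnus coordinate on the commutators of each degree, up to
the degree: this is Euler's identity `∑ t_l ∂_l f = deg f • f` combined with the Jacobi identity. -/
theorem contract_snd_map [Fintype σ] [DecidableEq σ] (hφ : ∀ i, φ (y i) = MagnusLie.gen i)
    (e : σ →₀ ℕ) (i j : σ) :
    contract hmet y (φ (polyAd hmet y (monomial e 1) (genLie K y i j) : L)).2 =
      ((e.degree : K) + 2) • polyAd hmet y (monomial e 1) (genLie K y i j) := by
  set f : MvPolynomial σ K := monomial e 1 with hf
  have hE : ∑ l, X l * pderiv l f = (e.degree : MvPolynomial σ K) * f := by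
    rw [← nsmul_eq_mul]
    exact (isHomogeneous_monomial (1 : K) rfl).sum_X_mul_pderiv
  have hs : genLie K y j i = - genLie K y i j := by
    ext
    exact (lie_skew (y j) (y i)).symm
  have h1 : ∀ l i j : σ, polyAd hmet y (pderiv l (f * X i)) (genLie K y l j) =
      polyAd hmet y (pderiv l f) (polyAd hmet y (X i) (genLie K y l j)) +
        if l = i then polyAd hmet y f (genLie K y i j) else 0 := by
    intro l i j
    rw [pderiv_mul, map_add, map_mul, LinearMap.add_apply, Module.End.mul_apply]
    congr 1
    split_ifs with h
    · rw [h, pderiv_X_self, mul_one]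
    · rw [pderiv_X_of_ne (Ne.symm h)]
      simp
  rw [snd_map_polyAd hmet hφ, snd_map_genLie hφ, smul_sub, ← Pi.single_smul, ← Pi.single_smul,
    map_sub, contract_single, contract_single, ← Finset.sum_sub_distrib]
  simp only [smul_eq_mul, h1]
  have h2 : ∀ l : σ, (polyAd hmet y (pderiv l f) (polyAd hmet y (X i) (genLie K y l j)) +
      if l = i then polyAd hmet y f (genLie K y i j) else 0) -
      (polyAd hmet y (pderiv l f) (polyAd hmet y (X j) (genLie K y l i)) +
        if l = j then polyAd hmet y f (genLie K y j i) else 0) =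
      polyAd hmet y (X l * pderiv l f) (genLie K y i j) +
      ((if l = i then polyAd hmet y f (genLie K y i j) else 0) +
        if l = j then polyAd hmet y f (genLie K y i j) else 0) := by
    intro l
    rw [mul_comm (X l), map_mul, Module.End.mul_apply, ← polyAd_X_genLie hmet i j l, map_sub,
      hs, map_neg]
    split_ifs <;> abel
  simp only [h2]
  rw [Finset.sum_add_distrib, Finset.sum_add_distrib, Finset.sum_ite_eq', Finset.sum_ite_eq',
    if_pos (Finset.mem_univ _), if_pos (Finset.mem_univ _), ← LinearMap.sum_apply, ← map_sum, hE,
    ← nsmul_eq_mul, map_nsmul, add_smul, two_smul, Nat.cast_smul_eq_nsmul]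
  rfl

theorem contract_mem [Fintype σ] {n : ℕ} {p : σ → MvPolynomial σ K}
    (hp : ∀ i, p i ∈ polyOrderGE K σ (n + 1)) :
    (contract hmet y p : L) ∈ LieModule.lowerCentralSeries K L L (n + 1) := by
  have h : ∀ i j, (polyAd hmet y (pderiv j (p i)) (genLie K y j i) : L) ∈
      LieModule.lowerCentralSeries K L L (n + 1) := fun i j =>
    map_mem_of_mem_polyOrderGE
      (N := (LieModule.lowerCentralSeries K L L (n + 1)).toSubmodule)
      (((LieModule.lowerCentralSeries K L L 1).toSubmodule.subtype.comp
        (LinearMap.applyₗ (genLie K y j i))).comp (polyAd hmet y).toLinearMap)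
      (fun e he => LieModule.antitone_lowerCentralSeries K L L (by omega)
        (polyAd_monomial_mem hmet y e (genLie K y j i)))
      (pderiv_mem_polyOrderGE j (hp i))
  have h' : contract hmet y p ∈ (LieModule.lowerCentralSeries K L L (n + 1)).toSubmodule.comap
      (LieModule.lowerCentralSeries K L L 1).toSubmodule.subtype :=
    sum_mem fun i _ => sum_mem fun j _ => h i j
  exact h'

/-- On `L^{n+2}` the composite of the second Magnus coordinate with the contraction is
multiplication by `n + 2`, modulo `L^{n+3}`. -/
theorem contract_snd_map_sub_mem [Fintype σ] [DecidableEq σ]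
    (hgen : ∀ A : LieSubalgebra K L, (∀ i, y i ∈ A) → A = ⊤)
    (hφ : ∀ i, φ (y i) = MagnusLie.gen i) {n : ℕ} {a : L}
    (ha : a ∈ LieModule.lowerCentralSeries K L L (n + 1)) :
    (contract hmet y (φ a).2 : L) - ((n : K) + 2) • a ∈
      LieModule.lowerCentralSeries K L L (n + 2) := by
  let T : L →ₗ[K] L := (LieModule.lowerCentralSeries K L L 1).toSubmodule.subtype.comp
    ((contract hmet y).comp ((LinearMap.snd K (MvPolynomial σ K) (σ → MvPolynomial σ K)).comp
      (φ : L →ₗ[K] MagnusLie K σ))) - ((n : K) + 2) • LinearMap.id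
  refine (Submodule.span_le (p := (LieModule.lowerCentralSeries K L L (n + 2)).toSubmodule.comap
    T)).2 ?_ (mem_commSpan_of_mem_lowerCentralSeries hmet hgen ha)
  rintro _ ⟨e, i, j, he, rfl⟩
  change (contract hmet y (φ _).2 : L) - ((n : K) + 2) • _ ∈
      LieModule.lowerCentralSeries K L L (n + 2)
  rw [contract_snd_map hmet hφ, LieSubmodule.coe_smul, LinearMap.id_apply, ← sub_smul]
  rcases he.eq_or_lt with he | he
  · rw [he, sub_self, zero_smul]
    exact zero_mem _
  · exact (LieModule.lowerCentralSeries K L L (n + 2)).smul_mem _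
      (LieModule.antitone_lowerCentralSeries K L L (by omega)
        (polyAd_monomial_mem hmet y e (genLie K y i j)))

/-- The second Magnus coordinate takes `L^{n+2}` to polynomials of order at least `n + 1`. -/
theorem snd_map_mem [DecidableEq σ]
    (hmet : ∀ a ∈ LieModule.lowerCentralSeries K L L 1,
      ∀ b ∈ LieModule.lowerCentralSeries K L L 1, ⁅a, b⁆ = 0)
    (hgen : ∀ A : LieSubalgebra K L, (∀ i, y i ∈ A) → A = ⊤)
    (hφ : ∀ i, φ (y i) = MagnusLie.gen i) {n : ℕ} {a : L}
    (ha : a ∈ LieModule.lowerCentralSeries K L L (n + 1)) (i : σ) :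
    (φ a).2 i ∈ polyOrderGE K σ (n + 1) := by
  let T : L →ₗ[K] MvPolynomial σ K := (LinearMap.proj i).comp
    ((LinearMap.snd K (MvPolynomial σ K) (σ → MvPolynomial σ K)).comp
      (φ : L →ₗ[K] MagnusLie K σ))
  refine (Submodule.span_le (p := (polyOrderGE K σ (n + 1)).comap T)).2 ?_
    (mem_commSpan_of_mem_lowerCentralSeries hmet hgen ha)
  rintro _ ⟨e, k, l, he, rfl⟩
  change (φ _).2 i ∈ polyOrderGE K σ (n + 1)
  have hX : ∀ j, monomial e 1 * X j ∈ polyOrderGE K σ (n + 1) := by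
    intro j
    rw [mul_comm, X_mul_mem_polyOrderGE_succ]
    intro d hd
    rw [coeff_monomial, if_neg]
    rintro rfl
    omega
  rw [snd_map_polyAd hmet hφ, snd_map_genLie hφ, smul_sub, ← Pi.single_smul, ← Pi.single_smul,
    Pi.sub_apply]
  refine sub_mem ?_ ?_
  · by_cases h : i = l
    · subst h
      simpa using hX k
    · simp [h]
  · by_cases h : i = k
    · subst h
      simpa using hX l
    · simp [h]

/-- In a metabelian Lie algebra with at least two generators that has a Magnus representation, an
element of `L^{k+1}` whose brackets with the generators lie in `L^{k+3}` itself lies in `L^{k+2}`: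
the associated graded Lie algebra has trivial center.  In degree at least two, the second Magnus
coordinate of `[y_i, a]` is `t_i` times that of `a`, so the latter has high order as well, and the
contraction recovers `a` from it. -/
theorem mem_lowerCentralSeries_of_lie_mem [CharZero K] [Fintype σ] [Nontrivial σ] [DecidableEq σ]
    (hmet : ∀ a ∈ LieModule.lowerCentralSeries K L L 1,
      ∀ b ∈ LieModule.lowerCentralSeries K L L 1, ⁅a, b⁆ = 0)
    (hgen : ∀ A : LieSubalgebra K L, (∀ i, y i ∈ A) → A = ⊤)
    (hφ : ∀ i, φ (y i) = MagnusLie.gen i) {k : ℕ} {a : L}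
    (ha : a ∈ LieModule.lowerCentralSeries K L L k)
    (h : ∀ i, ⁅y i, a⁆ ∈ LieModule.lowerCentralSeries K L L (k + 2)) :
    a ∈ LieModule.lowerCentralSeries K L L (k + 1) := by
  rcases k with _ | n
  · obtain ⟨v, hv, s, hs, rfl⟩ := exists_add_commSpan hmet hgen a
    have hs1 := commSpan_zero_le hmet y hs
    obtain ⟨c, rfl⟩ := (Submodule.mem_span_range_iff_exists_fun K).1 hv
    suffices hc : ∀ i, c i = 0 by simpa [hc] using hs1
    intro i
    obtain ⟨j, hj⟩ := exists_ne i
    have hc : (φ (∑ l, c l • y l)).2 i = C (c i) := by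
      let T : L →ₗ[K] MvPolynomial σ K := (LinearMap.proj i).comp
        ((LinearMap.snd K (MvPolynomial σ K) (σ → MvPolynomial σ K)).comp
          (φ : L →ₗ[K] MagnusLie K σ))
      have hT : ∀ l, T (y l) = if l = i then 1 else 0 := by
        intro l
        change (φ (y l)).2 i = _
        rw [hφ, MagnusLie.snd_gen, Pi.single_apply]
        simp only [eq_comm]
      change T _ = _
      simp [hT, smul_eq_C_mul]
    have h1 : ⁅y j, ∑ i, c i • y i⁆ ∈ LieModule.lowerCentralSeries K L L 2 := by
      have := sub_mem (h j) (lie_mem_lowerCentralSeries_succ (y j) hs1)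
      rwa [← lie_sub, add_sub_cancel_right] at this
    -- The coefficient of `t_j` in the `i`-th coordinate of `φ [y_j, ∑ c_l y_l]` is `c_i`.
    have h2 := snd_map_mem hmet hgen hφ h1 i
    have h3 := h2 (Finsupp.single j 1) (by simp)
    rwa [LieHom.map_lie, hφ, MagnusLie.snd_lie, MagnusLie.fst_gen, MagnusLie.snd_gen, Pi.sub_apply,
      Pi.smul_apply, Pi.smul_apply, hc, Pi.single_eq_of_ne hj.symm, smul_zero, sub_zero,
      smul_eq_mul, coeff_X_mul', if_pos (by simp), tsub_self, coeff_zero_C] at h3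
  · obtain ⟨i, -⟩ := exists_pair_ne σ
    have h1 : ∀ j, (φ a).2 j ∈ polyOrderGE K σ (n + 2) := by
      intro j
      have h2 := snd_map_mem hmet hgen hφ (h i) j
      rw [snd_map_lie_gen hφ i (LieModule.antitone_lowerCentralSeries K L L (by omega) ha)] at h2
      exact (X_mul_mem_polyOrderGE_succ i).1 h2
    have h3 := sub_mem (contract_mem hmet (y := y) h1) (contract_snd_map_sub_mem hmet hgen hφ ha)
    rw [sub_sub_cancel] at h3
    have h4 : ((n : K) + 2) ≠ 0 := by exact_mod_cast (Nat.succ_ne_zero (n + 1))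
    have h5 := (LieModule.lowerCentralSeries K L L (n + 2)).smul_mem ((n : K) + 2)⁻¹ h3
    rwa [inv_smul_smul₀ h4] at h5

end Center

end MagnusEmbedding

/-! ### The free metabelian Lie algebra -/

namespace FreeMetabelian

variable {K : Type*} [Field K] {m : ℕ}

theorem mem_derivedSeries_one {L : Type*} [LieRing L] [LieAlgebra K L] (a b : L) :
    ⁅a, b⁆ ∈ LieAlgebra.derivedSeries K L 1 := by
  rw [LieAlgebra.derivedSeries, LieAlgebra.derivedSeriesOfIdeal_succ]
  exact LieSubmodule.lie_mem_lie (LieSubmodule.mem_top a) (LieSubmodule.mem_top b)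

theorem lie_lie_lie_eq_zero (a b c d : FreeMetabelian K m) : ⁅⁅a, b⁆, ⁅c, d⁆⁆ = 0 := by
  obtain ⟨a, rfl⟩ := LieSubmodule.Quotient.surjective_mk' _ a
  obtain ⟨b, rfl⟩ := LieSubmodule.Quotient.surjective_mk' _ b
  obtain ⟨c, rfl⟩ := LieSubmodule.Quotient.surjective_mk' _ c
  obtain ⟨d, rfl⟩ := LieSubmodule.Quotient.surjective_mk' _ d
  suffices h : ⁅⁅a, b⁆, ⁅c, d⁆⁆ ∈ LieAlgebra.derivedSeries K (FreeLieAlgebra K (Fin m)) 2 from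
    LieSubmodule.Quotient.mk_eq_zero'.2 h
  rw [LieAlgebra.derivedSeries, LieAlgebra.derivedSeriesOfIdeal_succ]
  exact LieSubmodule.lie_mem_lie (mem_derivedSeries_one a b) (mem_derivedSeries_one c d)

/-- The commutator ideal of the free metabelian Lie algebra is abelian. -/
theorem lie_eq_zero_of_mem : ∀ a ∈ LieModule.lowerCentralSeries K (FreeMetabelian K m)
    (FreeMetabelian K m) 1, ∀ b ∈ LieModule.lowerCentralSeries K (FreeMetabelian K m)
    (FreeMetabelian K m) 1, ⁅a, b⁆ = 0 := by
  have h1 : ∀ c d : FreeMetabelian K m, ∀ a ∈ LieModule.lowerCentralSeries K (FreeMetabelian K m)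
      (FreeMetabelian K m) 1, ⁅⁅c, d⁆, a⁆ = 0 := fun c d a ha =>
    lowerCentralSeries_succ_le (N := LinearMap.ker
      (LieModule.toEnd K (FreeMetabelian K m) (FreeMetabelian K m) ⁅c, d⁆))
      (fun e f _ => lie_lie_lie_eq_zero c d e f) ha
  intro a ha b hb
  rw [← lie_skew, neg_eq_zero]
  refine lowerCentralSeries_succ_le (N := LinearMap.ker
    (LieModule.toEnd K (FreeMetabelian K m) (FreeMetabelian K m) b)) (fun e f _ => ?_) ha
  rw [LinearMap.mem_ker, LieModule.toEnd_apply_apply, ← lie_skew, h1 e f b hb, neg_zero]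

theorem eq_top_of_gen_mem (A : LieSubalgebra K (FreeMetabelian K m))
    (hA : ∀ i, gen K m i ∈ A) : A = ⊤ := by
  let q : FreeLieAlgebra K (Fin m) →ₗ⁅K⁆ FreeMetabelian K m :=
    { toFun := fun a => LieSubmodule.Quotient.mk a
      map_add' := fun _ _ => rfl
      map_smul' := fun _ _ => rfl
      map_lie' := rfl }
  let g : FreeLieAlgebra K (Fin m) →ₗ⁅K⁆ A := FreeLieAlgebra.lift K fun i => ⟨gen K m i, hA i⟩
  have h : A.incl.comp g = q := by
    refine FreeLieAlgebra.hom_ext fun i => ?_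
    rw [LieHom.comp_apply, FreeLieAlgebra.lift_of_apply]
    rfl
  refine SetLike.ext fun x => ⟨fun _ => LieSubalgebra.mem_top x, fun _ => ?_⟩
  obtain ⟨x, rfl⟩ := LieSubmodule.Quotient.surjective_mk' _ x
  have hx : A.incl (g x) = q x := LieHom.congr_fun h x
  change q x ∈ A
  rw [← hx]
  exact (g x).2

/-- The Magnus representation of the free Lie algebra. -/
def freeMagnus (K : Type*) [Field K] (m : ℕ) :
    FreeLieAlgebra K (Fin m) →ₗ⁅K⁆ MagnusLie K (Fin m) :=
  FreeLieAlgebra.lift K MagnusLie.gen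

theorem freeMagnus_eq_zero {x : FreeLieAlgebra K (Fin m)}
    (hx : x ∈ LieAlgebra.derivedSeries K (FreeLieAlgebra K (Fin m)) 2) :
    freeMagnus K m x = 0 := by
  have h1 : ∀ a ∈ LieAlgebra.derivedSeries K (FreeLieAlgebra K (Fin m)) 1,
      (freeMagnus K m a).1 = 0 := fun a ha => fst_map_eq_zero _ (by
    rwa [LieAlgebra.derivedSeries, LieAlgebra.derivedSeriesOfIdeal_succ,
      LieAlgebra.derivedSeriesOfIdeal_zero] at ha)
  rw [LieAlgebra.derivedSeries, LieAlgebra.derivedSeriesOfIdeal_succ,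
    ← LieSubmodule.mem_toSubmodule, LieSubmodule.lieIdeal_oper_eq_linear_span'] at hx
  refine (Submodule.span_le (p := LinearMap.ker
    (freeMagnus K m : FreeLieAlgebra K (Fin m) →ₗ[K] MagnusLie K (Fin m)))).2 ?_ hx
  rintro _ ⟨a, ha, b, hb, rfl⟩
  change freeMagnus K m ⁅a, b⁆ = 0
  rw [LieHom.map_lie]
  refine MagnusLie.ext rfl fun i => ?_
  rw [MagnusLie.snd_lie, h1 a ha, h1 b hb]
  simp

/-- The Magnus representation `y_i ↦ t_i + e_i` of the free metabelian Lie algebra. -/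
def magnus (K : Type*) [Field K] (m : ℕ) : FreeMetabelian K m →ₗ⁅K⁆ MagnusLie K (Fin m) :=
  { Submodule.liftQ (LieAlgebra.derivedSeries K (FreeLieAlgebra K (Fin m)) 2).toSubmodule
      (freeMagnus K m : FreeLieAlgebra K (Fin m) →ₗ[K] MagnusLie K (Fin m))
      (fun _ hx => freeMagnus_eq_zero hx) with
    map_lie' := by
      intro a b
      obtain ⟨a, rfl⟩ := LieSubmodule.Quotient.surjective_mk' _ a
      obtain ⟨b, rfl⟩ := LieSubmodule.Quotient.surjective_mk' _ b
      exact LieHom.map_lie (freeMagnus K m) a b }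

theorem magnus_gen (i : Fin m) : magnus K m (gen K m i) = MagnusLie.gen i :=
  FreeLieAlgebra.lift_of_apply _ _

/-- In the free metabelian Lie algebra of rank at least `2`, an element of `F^{k+1}` all of whose
brackets lie in `F^{k+3}` belongs to `F^{k+2}`. -/
theorem mem_lowerCentralSeries_succ [CharZero K] (hm : 2 ≤ m) {k : ℕ} {a : FreeMetabelian K m}
    (ha : a ∈ LieModule.lowerCentralSeries K (FreeMetabelian K m) (FreeMetabelian K m) k)
    (h : ∀ b : FreeMetabelian K m, ⁅b, a⁆ ∈
      LieModule.lowerCentralSeries K (FreeMetabelian K m) (FreeMetabelian K m) (k + 2)) :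
    a ∈ LieModule.lowerCentralSeries K (FreeMetabelian K m) (FreeMetabelian K m) (k + 1) := by
  have : Nontrivial (Fin m) := Fin.nontrivial_iff_two_le.2 hm
  exact mem_lowerCentralSeries_of_lie_mem lie_eq_zero_of_mem eq_top_of_gen_mem magnus_gen ha
    fun i => h (gen K m i)

end FreeMetabelian

namespace LieCompletion

/-! ### The filtration of the completion -/

section Filtration

variable {R L : Type*} [CommRing R] [LieRing L] [LieAlgebra R L]

theorem exists_mk_eq_proj (k : ℕ) (x : LieCompletion R L) :
    ∃ a : L, (LieSubmodule.Quotient.mk a : L ⧸ LieModule.lowerCentralSeries R L L k) = proj k x :=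
  LieSubmodule.Quotient.surjective_mk' _ _

theorem mk_eq_proj_of_le {j k : ℕ} (h : j ≤ k) {x : LieCompletion R L} {a : L}
    (ha : (LieSubmodule.Quotient.mk a : L ⧸ LieModule.lowerCentralSeries R L L k) = proj k x) :
    (LieSubmodule.Quotient.mk a : L ⧸ LieModule.lowerCentralSeries R L L j) = proj j x := by
  induction k, h using Nat.le_induction with
  | base => exact ha
  | succ k _ ih => exact ih (x.2 k a ha)

theorem proj_eq_zero_of_le {j k : ℕ} (h : j ≤ k) {x : LieCompletion R L} (hx : proj k x = 0) :
    proj j x = 0 := by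
  obtain ⟨a, ha⟩ := exists_mk_eq_proj k x
  rw [← mk_eq_proj_of_le h ha]
  rw [hx] at ha
  exact LieSubmodule.Quotient.mk_eq_zero'.2
    (LieModule.antitone_lowerCentralSeries R L L h (LieSubmodule.Quotient.mk_eq_zero'.1 ha))

@[simp] theorem proj_neg (k : ℕ) (x : LieCompletion R L) : proj k (-x) = -proj k x := rfl

@[simp] theorem proj_sub (k : ℕ) (x y : LieCompletion R L) :
    proj k (x - y) = proj k x - proj k y := rfl

/-- The projection onto `L / L^{k+1}` as a linear map. -/
def projHom (R L : Type*) [CommRing R] [LieRing L] [LieAlgebra R L] (k : ℕ) :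
    LieCompletion R L →ₗ[R] L ⧸ LieModule.lowerCentralSeries R L L k where
  toFun := proj k
  map_add' := proj_add k
  map_smul' c x := proj_smul k c x

theorem proj_zero_eq (x : LieCompletion R L) : proj 0 x = 0 := by
  obtain ⟨a, ha⟩ := exists_mk_eq_proj 0 x
  rw [← ha]
  exact LieSubmodule.Quotient.mk_eq_zero'.2 (by simp)

theorem mem_of_proj_eq_zero {j k : ℕ} (h : j ≤ k) {x : LieCompletion R L} (hx : proj j x = 0)
    {a : L}
    (ha : (LieSubmodule.Quotient.mk a : L ⧸ LieModule.lowerCentralSeries R L L k) = proj k x) :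
    a ∈ LieModule.lowerCentralSeries R L L j := by
  rw [← LieSubmodule.Quotient.mk_eq_zero', mk_eq_proj_of_le h ha, hx]

/-- Compatibility of the bracket with the filtration of the completion by the kernels of `proj`.
The shift by one comes from `proj k` being the projection onto `L / L^{k+1}`. -/
theorem proj_lie_eq_zero {i j : ℕ} {x y : LieCompletion R L} (hx : proj i x = 0)
    (hy : proj j y = 0) : proj (i + j + 1) ⁅x, y⁆ = 0 := by
  obtain ⟨a, ha⟩ := exists_mk_eq_proj (i + j + 1) x
  obtain ⟨b, hb⟩ := exists_mk_eq_proj (i + j + 1) y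
  rw [proj_lie, ← ha, ← hb, ← LieSubmodule.Quotient.mk_bracket, LieSubmodule.Quotient.mk_eq_zero']
  exact lie_mem_lowerCentralSeries (mem_of_proj_eq_zero (by omega) hx ha)
    (mem_of_proj_eq_zero (by omega) hy hb)

theorem proj_lie_eq_zero_left {i : ℕ} {x : LieCompletion R L} (y : LieCompletion R L)
    (hx : proj i x = 0) : proj (i + 1) ⁅x, y⁆ = 0 := by
  have h := proj_lie_eq_zero hx (proj_zero_eq y)
  rwa [add_zero] at h

theorem proj_rad_pow_eq_zero {i : ℕ} {x : LieCompletion R L} (y : LieCompletion R L)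
    (hx : proj i x = 0) (n : ℕ) : proj (i + n) ((rad y ^ n) x) = 0 := by
  induction n with
  | zero => simpa using hx
  | succ n ih =>
    rw [pow_succ', Module.End.mul_apply, rad_apply]
    exact proj_lie_eq_zero_left y ih

/-- In `L / L^{k+1}` the sum of a summable family is computed by any finite set outside of which
the family vanishes. -/
theorem proj_tsum {ι : Type*} {f : ι → LieCompletion R L} (hf : Summable f) (k : ℕ)
    (s : Finset ι) (hs : ∀ i ∉ s, proj k (f i) = 0) :
    proj k (∑' i, f i) = ∑ i ∈ s, proj k (f i) := by
  let _ : TopologicalSpace (L ⧸ LieModule.lowerCentralSeries R L L k) := ⊥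
  have : DiscreteTopology (L ⧸ LieModule.lowerCentralSeries R L L k) := ⟨rfl⟩
  have hc : Continuous (projHom R L k) :=
    continuous_iInf_dom (i := k) continuous_induced_dom
  have h1 := hf.hasSum.map (projHom R L k) hc
  have h2 : HasSum (projHom R L k ∘ f) (∑ i ∈ s, (projHom R L k ∘ f) i) :=
    hasSum_sum_of_ne_finset_zero hs
  exact h1.unique h2

end Filtration
end LieCompletion

namespace LieCompletion

/-! ### The power series module structure on the completed commutator ideal -/

section Action

variable {R L : Type*} [CommRing R] [LieRing L] [LieAlgebra R L]

theorem proj_one_lie (x y : LieCompletion R L) : proj 1 ⁅x, y⁆ = 0 :=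
  proj_lie_eq_zero_left y (proj_zero_eq x)

theorem proj_one_rad_pow {y : LieCompletion R L} (hy : proj 1 y = 0) (z : LieCompletion R L)
    (n : ℕ) : proj 1 ((rad z ^ n) y) = 0 :=
  proj_eq_zero_of_le (by omega) (proj_rad_pow_eq_zero z hy n)

/-- The exponents `e` with `e 0 + e 1 ≤ k`. -/
def degreeLE (k : ℕ) : Finset (Fin 2 →₀ ℕ) := (Finsupp.finite_of_degree_le (σ := Fin 2) k).toFinset

theorem mem_degreeLE {k : ℕ} {e : Fin 2 →₀ ℕ} : e ∈ degreeLE k ↔ e 0 + e 1 ≤ k := by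
  rw [degreeLE, Set.Finite.mem_toFinset, Set.mem_ofPred_eq, Finsupp.degree_eq_sum,
    Fin.sum_univ_two]

theorem proj_applySeries (k : ℕ) (f : MvPowerSeries (Fin 2) R) (p q x : LieCompletion R L) :
    proj k (applySeries f p q x) = ∑ e ∈ degreeLE k,
      MvPowerSeries.coeff e f • proj k ((rad q ^ e 1) ((rad p ^ e 0) x)) := by
  rw [applySeries, proj_tsum (summable_applySeries f p q x) k (degreeLE k)]
  · rfl
  · intro e he
    rw [mem_degreeLE, not_le] at he
    rw [proj_smul, proj_rad_pow_rad_pow he.le, smul_zero]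

theorem applySeries_add_apply (f : MvPowerSeries (Fin 2) R) (p q x y : LieCompletion R L) :
    applySeries f p q (x + y) = applySeries f p q x + applySeries f p q y := by
  ext k
  simp only [proj_applySeries, proj_add, map_add, smul_add, Finset.sum_add_distrib]

theorem applySeries_neg_apply (f : MvPowerSeries (Fin 2) R) (p q x : LieCompletion R L) :
    applySeries f p q (-x) = -applySeries f p q x := by
  ext k
  simp only [proj_applySeries, proj_neg, map_neg, smul_neg, Finset.sum_neg_distrib]

theorem applySeries_sub_apply (f : MvPowerSeries (Fin 2) R) (p q x y : LieCompletion R L) :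
    applySeries f p q (x - y) = applySeries f p q x - applySeries f p q y := by
  rw [sub_eq_add_neg, applySeries_add_apply, applySeries_neg_apply, ← sub_eq_add_neg]

theorem add_applySeries (f g : MvPowerSeries (Fin 2) R) (p q x : LieCompletion R L) :
    applySeries (f + g) p q x = applySeries f p q x + applySeries g p q x := by
  ext k
  simp only [proj_applySeries, proj_add, map_add, add_smul, Finset.sum_add_distrib]

theorem sub_applySeries (f g : MvPowerSeries (Fin 2) R) (p q x : LieCompletion R L) :
    applySeries (f - g) p q x = applySeries f p q x - applySeries g p q x := by
  ext k
  simp only [proj_applySeries, proj_sub, map_sub, sub_smul, Finset.sum_sub_distrib]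

theorem applySeries_eq_single (e : Fin 2 →₀ ℕ) (p q x : LieCompletion R L) :
    applySeries (MvPowerSeries.monomial e 1) p q x = (rad q ^ e 1) ((rad p ^ e 0) x) := by
  classical
  rw [applySeries, tsum_eq_single e]
  · simp
  · intro d hd
    rw [MvPowerSeries.coeff_monomial_ne hd, zero_smul]

theorem one_applySeries (p q x : LieCompletion R L) : applySeries 1 p q x = x := by
  simpa using applySeries_eq_single 0 p q x

theorem X_zero_applySeries (p q x : LieCompletion R L) :
    applySeries (MvPowerSeries.X 0) p q x = ⁅x, p⁆ := by
  simpa [MvPowerSeries.X] using applySeries_eq_single (Finsupp.single 0 1) p q x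

theorem X_one_applySeries (p q x : LieCompletion R L) :
    applySeries (MvPowerSeries.X 1) p q x = ⁅x, q⁆ := by
  simpa [MvPowerSeries.X] using applySeries_eq_single (Finsupp.single 1 1) p q x

theorem proj_one_applySeries (f : MvPowerSeries (Fin 2) R) (p q : LieCompletion R L)
    {x : LieCompletion R L} (hx : proj 1 x = 0) : proj 1 (applySeries f p q x) = 0 := by
  rw [proj_applySeries]
  refine Finset.sum_eq_zero fun e _ => ?_
  rw [proj_one_rad_pow (proj_one_rad_pow hx _ _), smul_zero]

variable (hI : ∀ x y : LieCompletion R L, proj 1 x = 0 → proj 1 y = 0 → ⁅x, y⁆ = 0)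

include hI

theorem rad_rad_comm {y : LieCompletion R L} (hy : proj 1 y = 0) (p q : LieCompletion R L) :
    rad p (rad q y) = rad q (rad p y) := by
  simp only [rad_apply]
  rw [lie_lie y q p, ← lie_skew q ⁅y, p⁆, hI y ⁅q, p⁆ hy (proj_one_lie q p), zero_sub, neg_neg]

theorem rad_rad_pow_comm {y : LieCompletion R L} (hy : proj 1 y = 0) (p q : LieCompletion R L)
    (n : ℕ) : rad p ((rad q ^ n) y) = (rad q ^ n) (rad p y) := by
  induction n with
  | zero => rfl
  | succ n ih =>
    rw [pow_succ', Module.End.mul_apply, Module.End.mul_apply,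
      rad_rad_comm hI (proj_one_rad_pow hy q n), ih]

theorem rad_pow_rad_pow_comm {y : LieCompletion R L} (hy : proj 1 y = 0)
    (p q : LieCompletion R L) (m n : ℕ) :
    (rad p ^ m) ((rad q ^ n) y) = (rad q ^ n) ((rad p ^ m) y) := by
  induction m with
  | zero => rfl
  | succ m ih =>
    rw [pow_succ', Module.End.mul_apply, Module.End.mul_apply, ih,
      rad_rad_pow_comm hI (proj_one_rad_pow hy p m)]

/-- Every `ad z` is linear over the power series on the completed commutator ideal. -/
theorem lie_applySeries (f : MvPowerSeries (Fin 2) R) (p q z : LieCompletion R L)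
    {x : LieCompletion R L} (hx : proj 1 x = 0) :
    ⁅z, applySeries f p q x⁆ = applySeries f p q ⁅z, x⁆ := by
  have h1 : ∀ e : Fin 2 →₀ ℕ, ⁅z, (rad q ^ e 1) ((rad p ^ e 0) x)⁆ =
      (rad q ^ e 1) ((rad p ^ e 0) ⁅z, x⁆) := by
    intro e
    rw [← lie_skew, ← lie_skew z x, map_neg, map_neg, ← rad_apply z x, ← rad_rad_pow_comm hI hx,
      ← rad_rad_pow_comm hI (proj_one_rad_pow hx _ _), rad_apply]
  ext k
  rw [proj_lie, proj_applySeries, proj_applySeries, lie_sum]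
  refine Finset.sum_congr rfl fun e _ => ?_
  rw [lie_smul, ← proj_lie, h1]

theorem rad_pow_applySeries (f : MvPowerSeries (Fin 2) R) (p q z : LieCompletion R L)
    {x : LieCompletion R L} (hx : proj 1 x = 0) (n : ℕ) :
    (rad z ^ n) (applySeries f p q x) = applySeries f p q ((rad z ^ n) x) := by
  induction n with
  | zero => rfl
  | succ n ih =>
    have h := lie_applySeries hI f p q z (proj_one_rad_pow hx z n)
    rw [pow_succ', Module.End.mul_apply, Module.End.mul_apply, ih, rad_apply, rad_apply, ← lie_skew,
      h, ← applySeries_neg_apply, lie_skew]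

/-- On the completed commutator ideal, `applySeries` is multiplicative in the series. -/
theorem mul_applySeries (f g : MvPowerSeries (Fin 2) R) (p q : LieCompletion R L)
    {x : LieCompletion R L} (hx : proj 1 x = 0) :
    applySeries (f * g) p q x = applySeries f p q (applySeries g p q x) := by
  classical
  have hmon : ∀ d e : Fin 2 →₀ ℕ, (rad q ^ e 1) ((rad p ^ e 0) ((rad q ^ d 1) ((rad p ^ d 0) x))) =
      (rad q ^ (d + e) 1) ((rad p ^ (d + e) 0) x) := by
    intro d e
    rw [rad_pow_rad_pow_comm hI (proj_one_rad_pow hx p _), ← Module.End.mul_apply,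
      ← pow_add, ← Module.End.mul_apply (rad p ^ e 0), ← pow_add, Finsupp.add_apply,
      Finsupp.add_apply, add_comm (d 0), add_comm (d 1)]
  ext k
  let F : (Fin 2 →₀ ℕ) × (Fin 2 →₀ ℕ) → L ⧸ LieModule.lowerCentralSeries R L L k := fun d =>
    (MvPowerSeries.coeff d.1 f * MvPowerSeries.coeff d.2 g) •
      proj k ((rad q ^ (d.1 + d.2) 1) ((rad p ^ (d.1 + d.2) 0) x))
  have hF : ∀ d, d.1 + d.2 ∉ degreeLE k → F d = 0 := by
    intro d hd
    rw [mem_degreeLE, not_le] at hd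
    change _ • _ = _
    rw [proj_rad_pow_rad_pow hd.le, smul_zero]
  have hR : proj k (applySeries f p q (applySeries g p q x)) =
      ∑ d ∈ degreeLE k ×ˢ degreeLE k, F d := by
    rw [proj_applySeries, Finset.sum_product]
    refine Finset.sum_congr rfl fun d _ => ?_
    rw [rad_pow_applySeries hI _ _ _ _ hx, rad_pow_applySeries hI _ _ _ _ (proj_one_rad_pow hx _ _),
      proj_applySeries, Finset.smul_sum]
    refine Finset.sum_congr rfl fun e _ => ?_
    rw [hmon, ← mul_smul]
  have hL : proj k (applySeries (f * g) p q x) =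
      ∑ e ∈ degreeLE k, ∑ d ∈ Finset.HasAntidiagonal.antidiagonal e, F d := by
    rw [proj_applySeries]
    refine Finset.sum_congr rfl fun e _ => ?_
    rw [MvPowerSeries.coeff_mul, Finset.sum_smul]
    refine Finset.sum_congr rfl fun d hd => ?_
    rw [← Finset.HasAntidiagonal.mem_antidiagonal.1 hd]
  have hmaps : ∀ d ∈ (degreeLE k ×ˢ degreeLE k).filter fun d => d.1 + d.2 ∈ degreeLE k,
      d.1 + d.2 ∈ degreeLE k := fun d hd => (Finset.mem_filter.1 hd).2
  rw [hL, hR, ← Finset.sum_filter_of_ne (p := fun d => d.1 + d.2 ∈ degreeLE k)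
    fun d _ hd => not_not.1 fun h => hd (hF d h)]
  refine Eq.trans ?_ (Finset.sum_fiberwise_of_maps_to hmaps F)
  refine Finset.sum_congr rfl fun e he => Finset.sum_congr ?_ fun _ _ => rfl
  ext d
  simp only [Finset.HasAntidiagonal.mem_antidiagonal, Finset.mem_filter, Finset.mem_product]
  refine ⟨?_, fun h => h.2⟩
  rintro rfl
  refine ⟨⟨⟨?_, ?_⟩, he⟩, rfl⟩ <;> rw [mem_degreeLE] at * <;>
    simp only [Finsupp.add_apply] at he <;> omega

/-- Substitution of power series corresponds to substitution of operators. -/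
theorem tsum_smul_rad_pow (f : PowerSeries R) {a : MvPowerSeries (Fin 2) R}
    (ha : MvPowerSeries.constantCoeff a = 0) {p q z : LieCompletion R L}
    (hz : ∀ y, proj 1 y = 0 → ⁅y, z⁆ = applySeries a p q y) {x : LieCompletion R L}
    (hx : proj 1 x = 0) :
    ∑' n : ℕ, PowerSeries.coeff n f • (rad z ^ n) x = applySeries (f.subst a) p q x := by
  have hpow : ∀ n, (rad z ^ n) x = applySeries (a ^ n) p q x := by
    intro n
    induction n with
    | zero => rw [pow_zero, pow_zero, one_applySeries, Module.End.one_apply]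
    | succ n ih =>
      rw [pow_succ', pow_succ', Module.End.mul_apply, rad_apply, hz _ (proj_one_rad_pow hx z n), ih,
        mul_applySeries hI _ _ _ _ hx]
  have hvan : ∀ k n, k ≤ n → proj k ((rad z ^ n) x) = 0 := fun k n h =>
    proj_eq_zero_of_le (by omega) (proj_rad_pow_eq_zero z hx n)
  have hs : Summable fun n : ℕ => PowerSeries.coeff n f • (rad z ^ n) x := by
    refine summable_of_finite _ fun k => (Set.finite_lt_nat k).subset fun n hn => ?_
    by_contra hk
    exact hn (by rw [proj_smul, hvan k n (not_lt.1 hk), smul_zero])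
  ext k
  rw [proj_tsum hs k (Finset.range (k + 1)), proj_applySeries]
  · have hc : ∀ e ∈ degreeLE k, MvPowerSeries.coeff e (f.subst a) =
        ∑ n ∈ Finset.range (k + 1), PowerSeries.coeff n f * MvPowerSeries.coeff e (a ^ n) := by
      intro e he
      rw [PowerSeries.coeff_subst (PowerSeries.HasSubst.of_constantCoeff_zero ha)]
      refine finsum_eq_finsetSum_of_support_subset _ fun n hn => ?_
      by_contra h
      refine hn ?_
      have hk : e.degree < n := by
        rw [mem_degreeLE] at he
        rw [Finset.coe_range, Set.mem_Iio, not_lt] at h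
        rw [Finsupp.degree_eq_sum, Fin.sum_univ_two]
        omega
      change _ • _ = _
      rw [MvPowerSeries.coeff_of_lt_order (lt_of_lt_of_le (by exact_mod_cast hk)
        (MvPowerSeries.le_order_pow_of_constantCoeff_eq_zero n ha)), smul_zero]
    have hR : ∑ e ∈ degreeLE k, MvPowerSeries.coeff e (f.subst a) •
          proj k ((rad q ^ e 1) ((rad p ^ e 0) x)) =
        ∑ e ∈ degreeLE k, ∑ n ∈ Finset.range (k + 1),
          (PowerSeries.coeff n f * MvPowerSeries.coeff e (a ^ n)) •
          proj k ((rad q ^ e 1) ((rad p ^ e 0) x)) :=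
      Finset.sum_congr rfl fun e he => by rw [hc e he, Finset.sum_smul]
    rw [hR, Finset.sum_comm]
    refine Finset.sum_congr rfl fun n _ => ?_
    rw [proj_smul, hpow, proj_applySeries, Finset.smul_sum]
    exact Finset.sum_congr rfl fun e _ => by rw [mul_smul]
  · intro n hn
    rw [proj_smul, hvan k n (by rw [Finset.mem_range] at hn; omega), smul_zero]

end Action
end LieCompletion

namespace MetabelianBCH

/-! ### Identities between the power series -/

section Series

variable (K : Type*) [Field K] [CharZero K]

theorem exp_subst_X_add_X :
    (PowerSeries.exp K).subst (MvPowerSeries.X 0 + MvPowerSeries.X 1 : MvPowerSeries (Fin 2) K) =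
      (PowerSeries.exp K).subst (MvPowerSeries.X 0 : MvPowerSeries (Fin 2) K) *
        (PowerSeries.exp K).subst (MvPowerSeries.X 1 : MvPowerSeries (Fin 2) K) := by
  ext e
  rw [PowerSeries.coeff_subst_X_zero_add_X_one, PowerSeries.coeff_subst_X_zero_subst_mul_X_one]
  have h0 : ∀ n : ℕ, (n.factorial : K) ≠ 0 := fun n => Nat.cast_ne_zero.2 n.factorial_ne_zero
  have h1 := h0 (e 0)
  have h2 := h0 (e 1)
  have h3 := h0 (e 0 + e 1)
  have h4 : ((e 0 + e 1).choose (e 0) : K) * ((e 0).factorial : K) * ((e 1).factorial : K) =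
      ((e 0 + e 1).factorial : K) := by
    have h := Nat.choose_mul_factorial_mul_factorial (Nat.le_add_right (e 0) (e 1))
    rw [Nat.add_sub_cancel_left] at h
    exact_mod_cast h
  simp only [PowerSeries.coeff_exp, one_div, map_inv₀, map_natCast]
  field_simp
  linear_combination h4

theorem mul_hSeries_subst {a : MvPowerSeries (Fin 2) K} (ha : PowerSeries.HasSubst a) :
    a * (hSeries K).subst a = (PowerSeries.exp K).subst a - 1 := by
  have h := congrArg (PowerSeries.substAlgHom (R := K) ha) (X_mul_hSeries K)
  rwa [map_mul, map_sub, map_one, PowerSeries.coe_substAlgHom, PowerSeries.subst_X ha] at h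

theorem X_add_X_ne_zero :
    (MvPowerSeries.X 0 + MvPowerSeries.X 1 : MvPowerSeries (Fin 2) K) ≠ 0 := by
  intro h
  have h1 := denom_ne_zero K
  rw [denom_eq, h, zero_mul] at h1
  exact h1 rfl

/-- `(1 + t₂ c) h(t₁ + t₂) = e^{t₂} h(t₁)`. -/
theorem one_add_mul_hSeries :
    (1 + MvPowerSeries.X 1 * cSeries K) *
      (hSeries K).subst (MvPowerSeries.X 0 + MvPowerSeries.X 1 : MvPowerSeries (Fin 2) K) =
    (PowerSeries.exp K).subst (MvPowerSeries.X 1 : MvPowerSeries (Fin 2) K) *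
      (hSeries K).subst (MvPowerSeries.X 0 : MvPowerSeries (Fin 2) K) := by
  have H0 := mul_hSeries_subst K (PowerSeries.HasSubst.X (S := K) (0 : Fin 2))
  have H1 := mul_hSeries_subst K (PowerSeries.HasSubst.X (S := K) (1 : Fin 2))
  have Hs := mul_hSeries_subst K
    ((PowerSeries.HasSubst.X (S := K) (0 : Fin 2)).add (PowerSeries.HasSubst.X (1 : Fin 2)))
  have Hc := cSeries_mul_denom K
  rw [denom_eq, numer] at Hc
  rw [exp_subst_X_add_X] at Hs
  refine mul_left_cancel₀ (X_add_X_ne_zero K) ?_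
  linear_combination Hs + MvPowerSeries.X 1 * Hc - H1 -
    (PowerSeries.exp K).subst (MvPowerSeries.X 1 : MvPowerSeries (Fin 2) K) * H0

/-- `(1 - t₁ c) h(t₁ + t₂) = h(t₂)`. -/
theorem one_sub_mul_hSeries :
    (1 - MvPowerSeries.X 0 * cSeries K) *
      (hSeries K).subst (MvPowerSeries.X 0 + MvPowerSeries.X 1 : MvPowerSeries (Fin 2) K) =
    (hSeries K).subst (MvPowerSeries.X 1 : MvPowerSeries (Fin 2) K) := by
  have H0 := mul_hSeries_subst K (PowerSeries.HasSubst.X (S := K) (0 : Fin 2))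
  have H1 := mul_hSeries_subst K (PowerSeries.HasSubst.X (S := K) (1 : Fin 2))
  have Hs := mul_hSeries_subst K
    ((PowerSeries.HasSubst.X (S := K) (0 : Fin 2)).add (PowerSeries.HasSubst.X (1 : Fin 2)))
  have Hc := cSeries_mul_denom K
  rw [denom_eq, numer] at Hc
  rw [exp_subst_X_add_X] at Hs
  refine mul_left_cancel₀ (X_add_X_ne_zero K) ?_
  linear_combination Hs - MvPowerSeries.X 0 * Hc - H1 -
    (PowerSeries.exp K).subst (MvPowerSeries.X 1 : MvPowerSeries (Fin 2) K) * H0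

end Series

end MetabelianBCH

namespace LieCompletion

open MetabelianBCH

/-! ### Exponentials of adjoint operators -/

section ExpAd

variable {K L : Type*} [Field K] [LieRing L] [LieAlgebra K L]

theorem proj_rad_pow_of_le {k n : ℕ} (h : k ≤ n) (z x : LieCompletion K L) :
    proj k ((rad z ^ n) x) = 0 :=
  proj_eq_zero_of_le (by omega) (proj_rad_pow_eq_zero z (proj_zero_eq x) n)

theorem proj_expAd (k : ℕ) (z x : LieCompletion K L) : proj k (expAd z x) =
    ∑ n ∈ Finset.range (k + 1), ((n.factorial : K)⁻¹) • proj k ((rad z ^ n) x) := by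
  rw [expAd, proj_tsum (summable_expAd z x) k (Finset.range (k + 1))]
  · rfl
  · intro n hn
    rw [Finset.mem_range, not_lt] at hn
    rw [proj_smul, proj_rad_pow_of_le (by omega), smul_zero]

theorem expAd_add (z x y : LieCompletion K L) : expAd z (x + y) = expAd z x + expAd z y := by
  ext k
  simp only [proj_expAd, proj_add, map_add, smul_add, Finset.sum_add_distrib]

/-- If `proj k (w - w') = 0`, then `(ad w)^(n+1) - (ad w')^(n+1)` raises the filtration degree by
`k + n + 1`. -/
theorem proj_pow_sub_pow {k : ℕ} {w w' : LieCompletion K L} (h : proj k (w - w') = 0)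
    (x : LieCompletion K L) (n : ℕ) :
    proj (k + n + 1) ((rad w ^ (n + 1)) x - (rad w' ^ (n + 1)) x) = 0 := by
  induction n with
  | zero =>
    rw [zero_add, pow_one, pow_one, rad_apply, rad_apply, ← lie_sub]
    have h1 := proj_lie_eq_zero (proj_zero_eq x) h
    rwa [zero_add] at h1
  | succ n ih =>
    have h1 : (rad w ^ (n + 1 + 1)) x - (rad w' ^ (n + 1 + 1)) x =
        ⁅(rad w ^ (n + 1)) x - (rad w' ^ (n + 1)) x, w⁆ + ⁅(rad w' ^ (n + 1)) x, w - w'⁆ := by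
      rw [pow_succ' _ (n + 1), pow_succ' _ (n + 1), Module.End.mul_apply, Module.End.mul_apply,
        rad_apply, rad_apply, sub_lie, lie_sub]
      abel
    have h2 := proj_lie_eq_zero_left w ih
    have h3 := proj_lie_eq_zero (proj_rad_pow_of_le le_rfl w' x) h (i := n + 1)
    rw [show n + 1 + k + 1 = k + n + 1 + 1 by omega] at h3
    rw [h1, proj_add]
    change proj (k + n + 1 + 1) _ + proj (k + n + 1 + 1) _ = 0
    rw [h2, h3, add_zero]

/-- If the associated graded Lie algebra has trivial center, in the sense of the hypothesis `hC`,
then `w` is determined by `exp (ad w)`: if `proj k (w - w') = 0`, the terms of order at least two in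
`exp (ad w) - exp (ad w')` vanish under `proj (k + 2)`, and hence so does `ad (w - w')`. -/
theorem eq_of_expAd_eq
    (hC : ∀ (k : ℕ) (d : LieCompletion K L), proj k d = 0 →
      (∀ x : LieCompletion K L, proj (k + 2) ⁅x, d⁆ = 0) → proj (k + 1) d = 0)
    {w w' : LieCompletion K L} (h : ∀ x, expAd w x = expAd w' x) : w = w' := by
  rw [← sub_eq_zero]
  ext k
  rw [proj_zero]
  induction k with
  | zero => exact proj_zero_eq _
  | succ k ih =>
    refine hC k _ ih fun x => ?_
    have h1 := congrArg (proj (k + 2)) (sub_eq_zero.2 (h x))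
    rw [proj_sub, proj_expAd, proj_expAd, ← Finset.sum_sub_distrib, proj_zero,
      Finset.sum_eq_single 1] at h1
    · rw [← smul_sub, pow_one, pow_one, Nat.factorial_one, Nat.cast_one, inv_one, one_smul,
        ← proj_sub, rad_apply, rad_apply, ← lie_sub] at h1
      exact h1
    · rintro n - hn
      rcases n with _ | _ | n
      · simp
      · exact absurd rfl hn
      · have h2 := proj_eq_zero_of_le (j := k + 2) (by omega) (proj_pow_sub_pow ih x (n + 1))
        rw [← smul_sub, ← proj_sub, h2, smul_zero]
    · simp

/-- `x exp (ad z) = x + [x, z] h(ad z)`, where `ad z` acts on the commutator ideal as a series `a`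
in `ad p` and `ad q`. -/
theorem expAd_eq_add_applySeries
    (hI : ∀ x y : LieCompletion K L, proj 1 x = 0 → proj 1 y = 0 → ⁅x, y⁆ = 0)
    {a : MvPowerSeries (Fin 2) K} (ha : MvPowerSeries.constantCoeff a = 0)
    {p q z : LieCompletion K L} (hz : ∀ y, proj 1 y = 0 → ⁅y, z⁆ = applySeries a p q y)
    (x : LieCompletion K L) :
    expAd z x = x + applySeries ((hSeries K).subst a) p q ⁅x, z⁆ := by
  rw [← tsum_smul_rad_pow hI _ ha hz (proj_one_lie x z)]
  have hs : Summable fun n : ℕ => PowerSeries.coeff n (hSeries K) • (rad z ^ n) ⁅x, z⁆ := by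
    refine summable_of_finite _ fun k => (Set.finite_lt_nat k).subset fun n hn => ?_
    by_contra hk
    exact hn (by rw [proj_smul, proj_rad_pow_of_le (not_lt.1 hk), smul_zero])
  ext k
  rw [proj_add, proj_expAd, Finset.sum_range_succ', proj_tsum hs k (Finset.range k), add_comm]
  · congr 1
    · simp
    · refine Finset.sum_congr rfl fun n _ => ?_
      rw [proj_smul, hSeries, PowerSeries.coeff_mk, pow_succ, Module.End.mul_apply, rad_apply]
  · intro n hn
    rw [Finset.mem_range, not_lt] at hn
    rw [proj_smul, proj_rad_pow_of_le hn, smul_zero]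

/-- On the completed commutator ideal, `f(ad p, ad q)` depends only on the linear components of `p`
and `q`. -/
theorem applySeries_congr
    (hI : ∀ x y : LieCompletion K L, proj 1 x = 0 → proj 1 y = 0 → ⁅x, y⁆ = 0)
    (f : MvPowerSeries (Fin 2) K) {p p' q q' : LieCompletion K L} (hp : proj 1 (p - p') = 0)
    (hq : proj 1 (q - q') = 0) {x : LieCompletion K L} (hx : proj 1 x = 0) :
    applySeries f p q x = applySeries f p' q' x := by
  have h1 : ∀ z z' : LieCompletion K L, proj 1 (z - z') = 0 → ∀ y, proj 1 y = 0 → ∀ n : ℕ,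
      (rad z ^ n) y = (rad z' ^ n) y := by
    intro z z' hz y hy n
    induction n with
    | zero => rfl
    | succ n ih =>
      rw [pow_succ', pow_succ', Module.End.mul_apply, Module.End.mul_apply, ih, ← sub_eq_zero,
        rad_apply, rad_apply, ← lie_sub]
      exact hI _ _ (proj_one_rad_pow hy z' n) hz
  rw [applySeries, applySeries]
  congr 1
  ext1 e
  rw [h1 p p' hp x hx, h1 q q' hq _ (proj_one_rad_pow hx _ _)]

variable [CharZero K]

theorem expAd_eq_applySeries
    (hI : ∀ x y : LieCompletion K L, proj 1 x = 0 → proj 1 y = 0 → ⁅x, y⁆ = 0)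
    {a : MvPowerSeries (Fin 2) K} (ha : MvPowerSeries.constantCoeff a = 0)
    {p q z : LieCompletion K L} (hz : ∀ y, proj 1 y = 0 → ⁅y, z⁆ = applySeries a p q y)
    {x : LieCompletion K L} (hx : proj 1 x = 0) :
    expAd z x = applySeries ((PowerSeries.exp K).subst a) p q x := by
  rw [← tsum_smul_rad_pow hI _ ha hz hx, expAd]
  simp [PowerSeries.coeff_exp]

/-- The Baker–Campbell–Hausdorff formula in a complete metabelian Lie algebra: both sides are `x`
plus a combination of `[x, u]` and `[x, v]` over the power series in `ad u` and `ad v`. -/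
theorem expAd_expAd
    (hI : ∀ x y : LieCompletion K L, proj 1 x = 0 → proj 1 y = 0 → ⁅x, y⁆ = 0)
    (u v x : LieCompletion K L) :
    expAd v (expAd u x) = expAd (H u v) x := by
  have hu : ∀ y, proj 1 y = 0 → ⁅y, u⁆ = applySeries (MvPowerSeries.X 0) u v y := fun y _ =>
    (X_zero_applySeries u v y).symm
  have hv : ∀ y, proj 1 y = 0 → ⁅y, v⁆ = applySeries (MvPowerSeries.X 1) u v y := fun y _ =>
    (X_one_applySeries u v y).symm
  have hw : ∀ y, proj 1 y = 0 →
      ⁅y, H u v⁆ = applySeries (MvPowerSeries.X 0 + MvPowerSeries.X 1) u v y := by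
    intro y hy
    rw [H, lie_add, lie_add, hI y _ hy (proj_one_applySeries _ _ _ (proj_one_lie u v)), add_zero,
      add_applySeries, hu y hy, hv y hy]
  have hxu := proj_one_lie x u
  have hxv := proj_one_lie x v
  have hxw : ⁅x, H u v⁆ =
      applySeries (1 + MvPowerSeries.X 1 * cSeries K) u v ⁅x, u⁆ +
        applySeries (1 - MvPowerSeries.X 0 * cSeries K) u v ⁅x, v⁆ := by
    rw [H, lie_add, lie_add, lie_applySeries hI _ _ _ _ (proj_one_lie u v), leibniz_lie x u v,
      ← lie_skew u ⁅x, v⁆, ← sub_eq_add_neg, applySeries_sub_apply, hv _ hxu, hu _ hxv,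
      ← mul_applySeries hI _ _ _ _ hxu, ← mul_applySeries hI _ _ _ _ hxv, add_applySeries,
      sub_applySeries, one_applySeries, one_applySeries, mul_comm (cSeries K), mul_comm (cSeries K)]
    abel
  rw [expAd_eq_add_applySeries hI (by simp) hu x, expAd_add,
    expAd_eq_applySeries hI (by simp) hv (proj_one_applySeries _ _ _ hxu),
    expAd_eq_add_applySeries hI (by simp) hv x, expAd_eq_add_applySeries hI (by simp) hw x, hxw,
    applySeries_add_apply, ← mul_applySeries hI _ _ _ _ hxu, ← mul_applySeries hI _ _ _ _ hxu,
    ← mul_applySeries hI _ _ _ _ hxv, mul_comm _ (1 + _), mul_comm _ (1 - _), one_add_mul_hSeries,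
    one_sub_mul_hSeries]
  abel

end ExpAd

end LieCompletion

/-! ### The completed free metabelian Lie algebra -/

namespace FreeMetabelian

open LieCompletion

variable {K : Type*} [Field K] {m : ℕ}

theorem lie_eq_zero_of_proj_one (x y : Hat K m) (hx : proj 1 x = 0) (hy : proj 1 y = 0) :
    ⁅x, y⁆ = 0 := by
  ext k
  rcases k with _ | k
  · exact proj_zero_eq _
  obtain ⟨a, ha⟩ := exists_mk_eq_proj (k + 1) x
  obtain ⟨b, hb⟩ := exists_mk_eq_proj (k + 1) y
  rw [proj_lie, ← ha, ← hb, ← LieSubmodule.Quotient.mk_bracket,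
    lie_eq_zero_of_mem a (mem_of_proj_eq_zero (by omega) hx ha) b
      (mem_of_proj_eq_zero (by omega) hy hb)]
  rfl

theorem proj_succ_eq_zero [CharZero K] (hm : 2 ≤ m) (k : ℕ) (d : Hat K m) (hd : proj k d = 0)
    (h : ∀ x : Hat K m, proj (k + 2) ⁅x, d⁆ = 0) : proj (k + 1) d = 0 := by
  obtain ⟨a, ha⟩ := exists_mk_eq_proj (k + 2) d
  rw [← mk_eq_proj_of_le (by omega : k + 1 ≤ k + 2) ha, LieSubmodule.Quotient.mk_eq_zero']
  refine mem_lowerCentralSeries_succ hm (mem_of_proj_eq_zero (by omega) hd ha) fun b => ?_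
  have h1 := h (ofLie b)
  rw [proj_lie, ← ha] at h1
  exact LieSubmodule.Quotient.mk_eq_zero'.1 h1

/-- The Baker–Campbell–Hausdorff series expanded in the linear and commutator components. -/
theorem H_eq [CharZero K] (u v : Hat K m) :
    MetabelianBCH.H u v = MetabelianBCH.H (linPart u) (linPart v)
        + (comPart u + applySeries (MetabelianBCH.cSeries K) (linPart u) (linPart v)
              (rad (linPart v) (comPart u)))
        + (comPart v - applySeries (MetabelianBCH.cSeries K) (linPart u) (linPart v)
              (rad (linPart u) (comPart v))) := by
  have hu : u = linPart u + comPart u := (add_sub_cancel _ _).symm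
  have hv : v = linPart v + comPart v := (add_sub_cancel _ _).symm
  have huv : ⁅u, v⁆ = ⁅linPart u, linPart v⁆ + ⁅comPart u, linPart v⁆ -
      ⁅comPart v, linPart u⁆ := by
    conv_lhs => rw [hu, hv]
    rw [lie_add, add_lie, add_lie,
      lie_eq_zero_of_proj_one _ _ (proj_one_comPart u) (proj_one_comPart v), add_zero,
      ← lie_skew (linPart u) (comPart v), ← sub_eq_add_neg]
  rw [MetabelianBCH.H, MetabelianBCH.H, applySeries_congr lie_eq_zero_of_proj_one _
    (proj_one_comPart u) (proj_one_comPart v) (proj_one_lie u v), huv, applySeries_sub_apply,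
    applySeries_add_apply, rad_apply, rad_apply]
  have huv' : u + v = linPart u + comPart u + (linPart v + comPart v) := by rw [← hu, ← hv]
  rw [huv']
  abel

end FreeMetabelian

end

/-- Operators act on the right of their arguments, so the product `exp (ad u) · exp (ad v)` sends
`x` to `expAd v (expAd u x)`. -/
theorem theorem2p1 (K : Type*) [Field K] [CharZero K] (m : ℕ) (hm : 2 ≤ m)
    (u v w : FreeMetabelian.Hat K m) :
    (∀ x : FreeMetabelian.Hat K m,
      LieCompletion.expAd v (LieCompletion.expAd u x) = LieCompletion.expAd w x) ↔
      w = MetabelianBCH.H (FreeMetabelian.linPart u) (FreeMetabelian.linPart v)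
        + (FreeMetabelian.comPart u +
            LieCompletion.applySeries (MetabelianBCH.cSeries K)
              (FreeMetabelian.linPart u) (FreeMetabelian.linPart v)
              (LieCompletion.rad (FreeMetabelian.linPart v) (FreeMetabelian.comPart u)))
        + (FreeMetabelian.comPart v -
            LieCompletion.applySeries (MetabelianBCH.cSeries K)
              (FreeMetabelian.linPart u) (FreeMetabelian.linPart v)
              (LieCompletion.rad (FreeMetabelian.linPart u) (FreeMetabelian.comPart v))) := by
  rw [← FreeMetabelian.H_eq]
  constructor
  · intro h
    refine LieCompletion.eq_of_expAd_eq (FreeMetabelian.proj_succ_eq_zero hm) fun x => ?_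
    rw [← h, LieCompletion.expAd_expAd FreeMetabelian.lie_eq_zero_of_proj_one]
  · rintro rfl x
    exact LieCompletion.expAd_expAd FreeMetabelian.lie_eq_zero_of_proj_one u v x
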